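/- For a meromorphic function $g$ on $\mathbb{C}$ let $m(r,g)$ and $T(r,g)$ be its Nevanlinna proximity and characteristic functions, and put $$\rho_{\log}(g)=\limsup_{r\to\infty}\frac{\log T(r,g)}{\log\log r},\quad \mu_{\log}(g)=\liminf_{r\to\infty}\frac{\log T(r,g)}{\log\log r},$$ $$\tau_{\log}(g)=\limsup_{r\to\infty}\frac{T(r,g)}{(\log r)^{\rho_{\log}(g)}},\quad \underline{\tau}_{\log}(g)=\liminf_{r\to\infty}\frac{T(r,g)}{(\log r)^{\mu_{\log}(g)}},\quad \delta(\infty,g)=\liminf_{r\to\infty}\frac{m(r,g)}{T(r,g)}$$ (logarithmic order, lower order, type, lower type, and deficiency of $\infty$; constants have logarithmic order and lower order $0$). **Theorem 1.2.** Let $n,m\ge 0$ be integers, let $c_0,\dots,c_n$ be distinct complex numbers, and let $A_{ij}$ $(0\le i\le n,\ 0\le j\le m)$ and $F$ be meromorphic functions on $\mathbb{C}$. Consider the equation $$\sum_{i=0}^{n}\sum_{j=0}^{m}A_{ij}(z)f^{(j)}(z+c_i)=F(z).\qquad(*)$$ Let $a,l\in\{0,\dots,n\}$ and $b\in\{0,\dots,m\}$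 with $(a,b)\ne(l,0)$. Put $S=\{F\}\cup\{A_{ij}:(i,j)\ne(a,b),(l,0)\}$, $\rho_{\log}(S)=\max\{\rho_{\log}(g):g\in S\}$, $\delta=\delta(\infty,A_{l0})$, and $$\Sigma=\sum_{\substack{(i,j)\neq(l,0),(a,b)\\ \rho_{\log}(A_{ij})=\mu_{\log}(A_{l0})}}\tau_{\log}(A_{ij})+\tau_{\log}(F).$$ Suppose that $\mu_{\log}(A_{l0})>0$, $\delta>0$, and (i) $\max\{\mu_{\log}(A_{ab}),\rho_{\log}(S)\}\le\mu_{\log}(A_{l0})<\infty$; (ii) $\underline{\tau}_{\log}(A_{ab})<\delta\,\underline{\tau}_{\log}(A_{l0})$ whenever $\mu_{\log}(A_{l0})=\mu_{\log}(A_{ab})$; (iii) $\Sigma<\delta\,\underline{\tau}_{\log}(A_{l0})<\infty$ whenever $\mu_{\log}(A_{l0})=\rho_{\log}(S)$; (iv) $\Sigma+\underline{\tau}_{\log}(A_{ab})<\delta\,\underline{\tau}_{\log}(A_{l0})<\infty$ whenever $\mu_{\log}(A_{l0})=\mu_{\log}(A_{ab})=\rho_{\log}(S)$. If $F\not\equiv0$,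 then every meromorphic solution $f$ of $(*)$ satisfies $\rho_{\log}(f)\ge\mu_{\log}(A_{l0})$. If $F\equiv0$, then every meromorphic solution $f\not\equiv0$ of $(*)$ satisfies $\rho_{\log}(f)\ge\mu_{\log}(A_{l0})+1$. Here $\rho_{\log}(f)=\infty$ is allowed. -/

import Mathlib

open Filter
open scoped ENNReal

namespace LogGrowth

open ValueDistribution

/-!
A meromorphic function on `ℂ` is a function `f : ℂ → ℂ` with `Meromorphic f`.  Its values on a
discrete set (for instance at its poles) carry no information, so identities between meromorphic
functions are stated as `=ᶠ[codiscrete ℂ]`, that is, off a closed discrete set.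
Mathlib's `ValueDistribution` provides the Nevanlinna functions: `proximity f a r` is
`m(r, 1/(f - a))` (and `m(r, f)` for `a = ⊤`), and `characteristic f ⊤ r` is `T(r, f)`.
-/

/-- The logarithmic order `limsup_{r → ∞} log T(r, f) / log log r`, an extended real number.
Constants, including those with `T(r, f) = 0`, have logarithmic order `0`. -/
noncomputable def logOrder (f : ℂ → ℂ) : EReal :=
  limsup (fun r : ℝ ↦
    ((Real.log (characteristic f ⊤ r) / Real.log (Real.log r) : ℝ) : EReal)) atTop

/-- The logarithmic lower order `liminf_{r → ∞} log T(r, f) / log log r`. -/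
noncomputable def logLowerOrder (f : ℂ → ℂ) : EReal :=
  liminf (fun r : ℝ ↦
    ((Real.log (characteristic f ⊤ r) / Real.log (Real.log r) : ℝ) : EReal)) atTop

/-- The logarithmic type `limsup_{r → ∞} T(r, f) / (log r) ^ ρ`, with values in `[0, ∞]`, of a
function of finite logarithmic order `ρ`. -/
noncomputable def logType (f : ℂ → ℂ) : ℝ≥0∞ :=
  limsup (fun r : ℝ ↦
    ENNReal.ofReal (characteristic f ⊤ r / Real.log r ^ (logOrder f).toReal)) atTop

/-- The logarithmic lower type `liminf_{r → ∞} T(r, f) / (log r) ^ μ`, with values in `[0, ∞]`, of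
a function of finite logarithmic lower order `μ`. -/
noncomputable def logLowerType (f : ℂ → ℂ) : ℝ≥0∞ :=
  liminf (fun r : ℝ ↦
    ENNReal.ofReal (characteristic f ⊤ r / Real.log r ^ (logLowerOrder f).toReal)) atTop

/-- The deficiency `δ(a, f) = liminf_{r → ∞} m(r, 1/(f - a)) / T(r, f)` of a value
`a ∈ ℂ ∪ {∞}` of a nonconstant meromorphic function `f`; for `a = ∞` the numerator is
`m(r, f)`. -/
noncomputable def deficiency (a : WithTop ℂ) (f : ℂ → ℂ) : ℝ≥0∞ :=
  liminf (fun r : ℝ ↦ ENNReal.ofReal (proximity f a r / characteristic f ⊤ r)) atTop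

variable {n m : ℕ}

/-- `f` is a meromorphic solution of the linear delay-differential equation
`∑ᵢ ∑ⱼ Aᵢⱼ(z) f⁽ʲ⁾(z + cᵢ) = F(z)`. -/
def IsMeromorphicSolution (c : Fin (n + 1) → ℂ) (A : Fin (n + 1) → Fin (m + 1) → ℂ → ℂ)
    (F f : ℂ → ℂ) : Prop :=
  Meromorphic f ∧
    (fun z ↦ ∑ i, ∑ j, A i j z * iteratedDeriv (j : ℕ) f (z + c i)) =ᶠ[codiscrete ℂ] F

/-- The pairs `(i, j)` of indices different from `(a, b)` and `(l, 0)`. -/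
def otherIndices (a l : Fin (n + 1)) (b : Fin (m + 1)) :
    Finset (Fin (n + 1) × Fin (m + 1)) :=
  {p | p ≠ (a, b) ∧ p ≠ (l, 0)}

/-- `ρ_log(S)`, the maximum of the logarithmic orders of the members of
`S = {F} ∪ {Aᵢⱼ : (i, j) ≠ (a, b), (l, 0)}`. -/
noncomputable def maxLogOrder (A : Fin (n + 1) → Fin (m + 1) → ℂ → ℂ) (F : ℂ → ℂ)
    (a l : Fin (n + 1)) (b : Fin (m + 1)) : EReal :=
  max (logOrder F) ((otherIndices a l b).sup fun p ↦ logOrder (A p.1 p.2))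

open Classical in
/-- The sum of the logarithmic types `τ_log(Aᵢⱼ)` over all `(i, j) ≠ (a, b), (l, 0)` with
`ρ_log(Aᵢⱼ) = μ_log(A_{l0})`, plus `τ_log(F)`. -/
noncomputable def sumLogType (A : Fin (n + 1) → Fin (m + 1) → ℂ → ℂ) (F : ℂ → ℂ)
    (a l : Fin (n + 1)) (b : Fin (m + 1)) : ℝ≥0∞ :=
  (∑ p ∈ otherIndices a l b with logOrder (A p.1 p.2) = logLowerOrder (A l 0),
    logType (A p.1 p.2)) + logType F

end LogGrowth

/-!
Divide the equation by `f (z + c l)`. This expresses `A l 0` through the other coefficients, the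
quotients `f⁽ʲ⁾(z + cᵢ) / f (z + c l)` and `F / f (z + c l)`, so that, up to a constant,
`m(r, A l 0)` is at most the sum of the characteristic functions of the other coefficients and of
`F`, plus the proximity functions of the quotients. The deficiency turns the left side into a
multiple of `T(r, A l 0)`. If `f` had too small a logarithmic order, the quotients would contribute
only `O((log r) ^ s)` for some `s` smaller than the lower order `μ` of `A l 0`
(`proximity_coefficient_le`), and the hypotheses on orders and types rule out the resulting
inequality between the coefficients (`not_eventually_proximity_le`). Only a lower limit is known for
`A a b`, so the contradiction is reached along a sequence of radii on which `A a b` is small; all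
other estimates hold for every large radius.

The heart of the matter is that `T(r, f) = O((log r) ^ (s + 1))` forces the proximity functions of
the quotients to be `O((log r) ^ s)` (`isBigO_proximity_iteratedDeriv_quotient`); this gain of one
exponent is the source of the `+ 1` in the homogeneous case. On the disc of radius `4 * r`, write
`f` as a rational function times a zero-free function `g` (`exists_ratProd_mul`).

* Each linear factor contributes a bounded amount to the proximity function of a quotient of
  translates or of a logarithmic derivative, because the mean of `log⁺ (1 / |z - a|)` over a large
  circle is bounded independently of `a`. The number of factors is at most a constant times
  `T((4 * r) ^ 2, f) / log r`, as one sees from the counting functions at the squared radius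
  (`sum_abs_divisor_mul_log_le`).
* `g` is a constant times the exponential of the Herglotz integral of `log |g|`
  (`exists_exp_representation`), whose derivative on the disc of half the radius is at most the mean
  of `|log |g||` divided by the radius, up to a constant. This is negligible.

Derivatives of higher order follow by induction, since `f'` satisfies the same growth hypothesis.
-/

namespace LogGrowth

open ValueDistribution MeromorphicOn Metric Set Topology Asymptotics

/-! ### Identities off a discrete set -/

lemma tendsto_add_const_codiscrete (c : ℂ) :
    Tendsto (· + c) (codiscrete ℂ) (codiscrete ℂ) := by
  intro S hS
  rw [mem_codiscrete] at hS
  rw [mem_map, mem_codiscrete]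
  intro x
  have h := hS (x + c)
  rw [disjoint_principal_right, compl_compl] at h ⊢
  have ht : Tendsto (· + c) (𝓝[≠] x) (𝓝[≠] (x + c)) :=
    tendsto_nhdsWithin_iff.2 ⟨((continuous_add_const c).tendsto x).mono_left nhdsWithin_le_nhds,
      eventually_nhdsWithin_of_forall fun y hy ↦ by simpa using hy⟩
  exact ht h

lemma eventuallyEq_comp_add {f g : ℂ → ℂ} (h : f =ᶠ[codiscrete ℂ] g) (c : ℂ) :
    (fun z ↦ f (z + c)) =ᶠ[codiscrete ℂ] fun z ↦ g (z + c) :=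
  (tendsto_add_const_codiscrete c).eventually h

lemma eventuallyEq_deriv {f g : ℂ → ℂ} (h : f =ᶠ[codiscrete ℂ] g) :
    deriv f =ᶠ[codiscrete ℂ] deriv g := by
  have ho := (mem_codiscrete'.1 h).1
  filter_upwards [h] with z hz
  exact EventuallyEq.deriv_eq (ho.mem_nhds hz)

lemma eventuallyEq_iteratedDeriv {f g : ℂ → ℂ} (h : f =ᶠ[codiscrete ℂ] g) (j : ℕ) :
    iteratedDeriv j f =ᶠ[codiscrete ℂ] iteratedDeriv j g := by
  induction j with
  | zero => simpa using h
  | succ j ih => simpa only [iteratedDeriv_succ] using eventuallyEq_deriv ih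

lemma meromorphic_comp_add {f : ℂ → ℂ} (hf : Meromorphic f) (c : ℂ) :
    Meromorphic fun z ↦ f (z + c) := fun x ↦
  meromorphicAt_comp_add_const_iff_meromorphicAt.2 (hf (x + c))

lemma meromorphic_iteratedDeriv {f : ℂ → ℂ} (hf : Meromorphic f) (j : ℕ) :
    Meromorphic (iteratedDeriv j f) := by
  rw [iteratedDeriv_eq_iterate]; exact hf.iterated_deriv

lemma eventually_ne_zero_of_order_ne_top {f : ℂ → ℂ} (hf : Meromorphic f)
    (h : ∀ z, meromorphicOrderAt f z ≠ ⊤) : ∀ᶠ z in codiscrete ℂ, f z ≠ 0 :=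
  (meromorphicOn_univ.2 hf).eventually_codiscreteWithin_apply_ne_zero fun x _ ↦ h x

lemma order_ne_top_of_not_eventuallyEq_zero {f : ℂ → ℂ} (hf : Meromorphic f)
    (h : ¬ f =ᶠ[codiscrete ℂ] 0) (z : ℂ) : meromorphicOrderAt f z ≠ ⊤ := by
  intro hz
  apply h
  have key : ∀ x, meromorphicOrderAt f x = ⊤ := by
    intro x
    by_contra hx
    exact (meromorphicOn_univ.2 hf).meromorphicOrderAt_ne_top_of_isPreconnected
      isPreconnected_univ (mem_univ x) (mem_univ z) hx hz
  change {x | f x = (0 : ℂ → ℂ) x} ∈ codiscrete ℂ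
  rw [mem_codiscrete]
  intro x
  rw [disjoint_principal_right, compl_compl]
  exact meromorphicOrderAt_eq_top_iff.1 (key x)

/-! ### Proximity functions of elementary expressions -/

lemma circleIntegrable_posLog {f : ℂ → ℂ} (hf : Meromorphic f) (r : ℝ) :
    CircleIntegrable (fun z ↦ Real.posLog ‖f z‖) 0 r :=
  hf.meromorphicOn.circleIntegrable_posLog_norm

lemma proximity_top_le_of_norm_le {f : ℂ → ℂ} (hf : Meromorphic f) {r K : ℝ} (hr : 0 ≤ r)
    (h : ∀ z, ‖z‖ = r → ‖f z‖ ≤ K) : proximity f ⊤ r ≤ Real.posLog K := by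
  rw [proximity_top]
  refine Real.circleAverage_mono_on_of_le_circle (circleIntegrable_posLog hf r) fun z hz ↦ ?_
  rw [mem_sphere_zero_iff_norm, abs_of_nonneg hr] at hz
  exact Real.posLog_le_posLog (norm_nonneg _) (h z hz)

lemma proximity_zero_fun (r : ℝ) : proximity (0 : ℂ → ℂ) ⊤ r = 0 := by
  simp [Pi.zero_def]

/-- The mean of `log⁺ (1 / |z - a|)` over a circle of radius at least `1` is at most `log 2`: by
Jensen's formula the mean of `log |z - a|` is `log (max r |a|)`, and
`log⁺ |z - a| ≤ log (2 max r |a|)` on the circle. -/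
lemma proximity_inv_sub_const_le (a : ℂ) {r : ℝ} (hr : 1 ≤ r) :
    proximity (fun z : ℂ ↦ (z - a)⁻¹) ⊤ r ≤ Real.log 2 := by
  have hm : Meromorphic (fun z : ℂ ↦ z - a) := by intro x; fun_prop
  have h1 := congrFun (proximity_sub_proximity_inv_eq_circleAverage hm) r
  have h2 : proximity (fun z : ℂ ↦ (z - a)⁻¹) ⊤ = proximity (fun z : ℂ ↦ z - a)⁻¹ ⊤ := rfl
  rw [h2]
  simp only [Pi.sub_apply] at h1
  have hr0 : r ≠ 0 := by positivity
  rw [circleAverage_log_norm_sub_const_eq_log_radius_add_posLog hr0] at h1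
  have h3 : proximity (fun z : ℂ ↦ z - a) ⊤ r ≤ Real.posLog (2 * max r ‖a‖) := by
    refine proximity_top_le_of_norm_le hm (by positivity) fun z hz ↦ ?_
    have := norm_sub_le z a
    have h4 := le_max_left r ‖a‖
    have h5 := le_max_right r ‖a‖
    linarith
  have h6 : Real.posLog (2 * max r ‖a‖) = Real.log 2 + Real.log (max r ‖a‖) := by
    have : 1 ≤ max r ‖a‖ := hr.trans (le_max_left _ _)
    rw [Real.posLog_eq_log (by rw [abs_of_nonneg] <;> linarith),
      Real.log_mul (by norm_num) (by positivity)]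
  have h7 : Real.log r + Real.posLog (r⁻¹ * ‖(0 : ℂ) - a‖) = Real.log (max r ‖a‖) := by
    rw [zero_sub, norm_neg]
    have hr' : 0 < r := by positivity
    rcases le_total r ‖a‖ with h | h
    · rw [max_eq_right h, Real.posLog_eq_log, Real.log_mul (by positivity), Real.log_inv]
      · ring
      · have : 0 < ‖a‖ := hr'.trans_le h
        positivity
      · rw [abs_of_nonneg (by positivity), ← div_eq_inv_mul, le_div_iff₀ hr']
        linarith
    · rw [max_eq_left h, (Real.posLog_eq_zero_iff _).2, add_zero]
      rw [abs_of_nonneg (by positivity), ← div_eq_inv_mul, div_le_one hr']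
      exact h
  linarith

lemma proximity_sub_const_le (a : ℂ) {r : ℝ} (hr : 1 ≤ r) (ha : ‖a‖ ≤ r) :
    proximity (fun z : ℂ ↦ z - a) ⊤ r ≤ Real.log r + Real.log 2 := by
  have hm : Meromorphic (fun z : ℂ ↦ z - a) := by intro x; fun_prop
  have h3 : proximity (fun z : ℂ ↦ z - a) ⊤ r ≤ Real.posLog (r * 2) := by
    refine proximity_top_le_of_norm_le hm (by positivity) fun z hz ↦ ?_
    have := norm_sub_le z a
    linarith
  rwa [Real.posLog_eq_log (by rw [abs_of_nonneg] <;> linarith),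
      Real.log_mul (by positivity) (by norm_num)] at h3

lemma proximity_mul_le {f g : ℂ → ℂ} (hf : Meromorphic f) (hg : Meromorphic g) (r : ℝ) :
    proximity (f * g) ⊤ r ≤ proximity f ⊤ r + proximity g ⊤ r :=
  proximity_mul_top_le hf hg r

lemma proximity_add_le {f g : ℂ → ℂ} (hf : Meromorphic f) (hg : Meromorphic g) (r : ℝ) :
    proximity (f + g) ⊤ r ≤ proximity f ⊤ r + proximity g ⊤ r + Real.log 2 :=
  proximity_add_top_le hf hg r

lemma proximity_prod_le {ι : Type*} (s : Finset ι) (f : ι → ℂ → ℂ) (hf : ∀ i, Meromorphic (f i))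
    (r : ℝ) : proximity (∏ i ∈ s, f i) ⊤ r ≤ ∑ i ∈ s, proximity (f i) ⊤ r := by
  classical
  induction s using Finset.induction with
  | empty =>
    have h : proximity (1 : ℂ → ℂ) ⊤ r = 0 := by
      simp [Pi.one_def]
    simp [h]
  | insert i s hi ih =>
    rw [Finset.prod_insert hi, Finset.sum_insert hi]
    exact (proximity_mul_le (hf i) (Meromorphic.prod fun j _ ↦ hf j) r).trans (by gcongr)

lemma proximity_zpow_le {f : ℂ → ℂ} (k : ℤ) {r K : ℝ}
    (h1 : proximity f ⊤ r ≤ K) (h2 : proximity f⁻¹ ⊤ r ≤ K) :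
    proximity (f ^ k) ⊤ r ≤ |(k : ℝ)| * K := by
  obtain ⟨n, rfl | rfl⟩ := k.eq_nat_or_neg
  · have : f ^ (n : ℤ) = f ^ n := by simp
    rw [this, proximity_pow_top]
    simp only [Pi.smul_apply, nsmul_eq_mul, Int.cast_natCast, Nat.abs_cast]
    gcongr
  · have : f ^ (-(n : ℤ)) = f⁻¹ ^ n := by simp
    rw [this, proximity_pow_top]
    simp only [Pi.smul_apply, nsmul_eq_mul, Int.cast_neg, Int.cast_natCast, abs_neg, Nat.abs_cast]
    gcongr

lemma proximity_congr {f g : ℂ → ℂ} (h : f =ᶠ[codiscrete ℂ] g) {r : ℝ} (hr : 1 ≤ r) :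
    proximity f ⊤ r = proximity g ⊤ r :=
  proximity_congr_codiscrete h (by positivity)

lemma proximity_le_characteristic (f : ℂ → ℂ) {r : ℝ} (hr : 1 ≤ r) :
    proximity f ⊤ r ≤ characteristic f ⊤ r := by
  have : 0 ≤ logCounting f ⊤ r := logCounting_nonneg hr
  simp [characteristic, this]

/-! ### Rational functions -/

/-- The rational function `∏ (z - u) ^ d u`, the product over `u ∈ s`. -/
noncomputable def ratProd (s : Finset ℂ) (d : ℂ → ℤ) : ℂ → ℂ :=
  ∏ u ∈ s, (fun z : ℂ ↦ z - u) ^ d u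

lemma meromorphic_sub_const (u : ℂ) : Meromorphic (fun z : ℂ ↦ z - u) := by intro x; fun_prop

lemma meromorphic_ratProd (s : Finset ℂ) (d : ℂ → ℤ) : Meromorphic (ratProd s d) :=
  Meromorphic.prod fun u _ ↦ (meromorphic_sub_const u).zpow

lemma ratProd_apply (s : Finset ℂ) (d : ℂ → ℤ) (z : ℂ) :
    ratProd s d z = ∏ u ∈ s, (z - u) ^ d u := by
  simp [ratProd, Finset.prod_apply]

lemma ratProd_inv (s : Finset ℂ) (d : ℂ → ℤ) : (ratProd s d)⁻¹ = ratProd s (fun u ↦ -d u) := by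
  ext z
  simp [ratProd_apply, Finset.prod_inv_distrib]

lemma ratProd_ne_zero (s : Finset ℂ) (d : ℂ → ℤ) {z : ℂ} (hz : z ∉ s) : ratProd s d z ≠ 0 := by
  rw [ratProd_apply, Finset.prod_ne_zero_iff]
  intro u hu
  exact zpow_ne_zero _ (sub_ne_zero.2 fun h ↦ hz (h ▸ hu))

lemma proximity_ratProd_le (s : Finset ℂ) (d : ℂ → ℤ) {r : ℝ} (hr : 1 ≤ r)
    (hs : ∀ u ∈ s, ‖u‖ ≤ r) :
    proximity (ratProd s d) ⊤ r ≤ (∑ u ∈ s, |(d u : ℝ)|) * (Real.log r + Real.log 2) := by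
  refine (proximity_prod_le s _ (fun u ↦ (meromorphic_sub_const u).zpow) r).trans ?_
  rw [Finset.sum_mul]
  refine Finset.sum_le_sum fun u hu ↦ proximity_zpow_le _ (proximity_sub_const_le u hr (hs u hu)) ?_
  have := proximity_inv_sub_const_le u hr
  have h0 := Real.log_nonneg hr
  have h2 : proximity (fun z : ℂ ↦ z - u)⁻¹ ⊤ r = proximity (fun z : ℂ ↦ (z - u)⁻¹) ⊤ r := rfl
  linarith

/-- A quotient of two linear factors with the same root, one shifted, is `1 + (c - c') / (z - a)`,
so its proximity function is bounded independently of the root. -/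
lemma proximity_linear_quotient_le (c c' u : ℂ) {r : ℝ} (hr : 1 ≤ r) :
    proximity (fun z : ℂ ↦ (z + c - u) / (z + c' - u)) ⊤ r
      ≤ 2 * Real.log 2 + Real.posLog ‖c - c'‖ := by
  have hm : Meromorphic (fun z : ℂ ↦ (z - (u - c'))⁻¹) := (meromorphic_sub_const _).inv
  have e : (fun z : ℂ ↦ (z + c - u) / (z + c' - u)) =ᶠ[codiscrete ℂ]
      (fun _ ↦ (1 : ℂ)) + (fun _ ↦ c - c') * (fun z : ℂ ↦ (z - (u - c'))⁻¹) := by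
    filter_upwards [(finite_singleton (u - c')).compl_mem_codiscrete] with z hz
    have hz' : z + c' - u ≠ 0 := fun h ↦ hz (by
      rw [mem_singleton_iff]; linear_combination h)
    have hz2 : z - (u - c') = z + c' - u := by ring
    simp only [Pi.add_apply, Pi.mul_apply, hz2]
    field_simp
    ring
  rw [proximity_congr e hr]
  have h1 := proximity_add_le (Meromorphic.const (1 : ℂ)) ((Meromorphic.const (c - c')).mul hm) r
  have h2 := proximity_mul_le (Meromorphic.const (c - c')) hm r
  have h3 := proximity_inv_sub_const_le (u - c') hr
  simp only [proximity_const] at h1 h2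
  simp only [norm_one, Real.posLog_one] at h1
  linarith

lemma proximity_ratProd_quotient_le (s : Finset ℂ) (d : ℂ → ℤ) (c c' : ℂ) {r : ℝ} (hr : 1 ≤ r) :
    proximity (fun z ↦ ratProd s d (z + c) / ratProd s d (z + c')) ⊤ r
      ≤ (∑ u ∈ s, |(d u : ℝ)|) * (2 * Real.log 2 + Real.posLog ‖c - c'‖) := by
  have e : (fun z ↦ ratProd s d (z + c) / ratProd s d (z + c')) =
      ∏ u ∈ s, (fun z : ℂ ↦ (z + c - u) / (z + c' - u)) ^ d u := by
    ext z
    simp [ratProd_apply, Finset.prod_apply, div_zpow]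
  have hm (u : ℂ) : Meromorphic (fun z : ℂ ↦ (z + c - u) / (z + c' - u)) := by
    intro x; fun_prop
  rw [e, Finset.sum_mul]
  refine (proximity_prod_le s _ (fun u ↦ (hm u).zpow) r).trans ?_
  refine Finset.sum_le_sum fun u hu ↦ proximity_zpow_le _ (proximity_linear_quotient_le c c' u hr) ?_
  have h2 : (fun z : ℂ ↦ (z + c - u) / (z + c' - u))⁻¹ =
      (fun z : ℂ ↦ (z + c' - u) / (z + c - u)) := by
    ext z; simp
  rw [h2, norm_sub_rev]
  exact proximity_linear_quotient_le c' c u hr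

lemma proximity_logDeriv_ratProd_le (s : Finset ℂ) (d : ℂ → ℤ) (hd : ∀ u ∈ s, d u ≠ 0) (c : ℂ)
    {r : ℝ} (hr : 1 ≤ r) :
    proximity (fun z ↦ ∑ u ∈ s, (d u : ℂ) / (z + c - u)) ⊤ r ≤ 3 * ∑ u ∈ s, |(d u : ℝ)| := by
  have e : (fun z ↦ ∑ u ∈ s, (d u : ℂ) / (z + c - u)) =
      ∑ u ∈ s, (fun _ : ℂ ↦ (d u : ℂ)) * fun z : ℂ ↦ (z - (u - c))⁻¹ := by
    ext z
    simp only [Finset.sum_apply, Pi.mul_apply, div_eq_mul_inv]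
    refine Finset.sum_congr rfl fun u _ ↦ ?_
    congr 2; ring
  have hm (u : ℂ) : Meromorphic (fun z : ℂ ↦ (z - (u - c))⁻¹) := (meromorphic_sub_const _).inv
  have h1 (u : ℂ) (hu : u ∈ s) : (1 : ℝ) ≤ |(d u : ℝ)| := by
    exact_mod_cast Int.one_le_abs (hd u hu)
  rw [e]
  have h := proximity_sum_top_le s (fun u ↦ (fun _ : ℂ ↦ (d u : ℂ)) * fun z : ℂ ↦ (z - (u - c))⁻¹)
    (fun u _ ↦ (Meromorphic.const _).mul (hm u)) r
  refine h.trans ?_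
  simp only [Pi.add_apply, Finset.sum_apply]
  have hcard : (s.card : ℝ) ≤ ∑ u ∈ s, |(d u : ℝ)| := by
    have := Finset.card_nsmul_le_sum s (fun u ↦ |(d u : ℝ)|) 1 h1
    simpa using this
  have hlog : Real.log s.card ≤ ∑ u ∈ s, |(d u : ℝ)| :=
    (Real.log_le_self (Nat.cast_nonneg _)).trans hcard
  have hterm : ∑ u ∈ s, proximity ((fun _ : ℂ ↦ (d u : ℂ)) * fun z : ℂ ↦ (z - (u - c))⁻¹) ⊤ r
      ≤ ∑ u ∈ s, 2 * |(d u : ℝ)| := by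
    refine Finset.sum_le_sum fun u hu ↦ ?_
    have h2 := proximity_mul_le (Meromorphic.const (d u : ℂ)) (hm u) r
    have h3 := proximity_inv_sub_const_le (u - c) hr
    have h4 : Real.posLog ‖(d u : ℂ)‖ ≤ |(d u : ℝ)| := by
      have h5 : ‖(d u : ℂ)‖ = |(d u : ℝ)| := by simp
      rw [h5, Real.posLog_abs, Real.posLog_apply]
      exact max_le (abs_nonneg _) (by
        rw [← Real.log_abs]; exact Real.log_le_self (abs_nonneg _))
    have h6 := Real.log_two_lt_d9
    have h7 := h1 u hu
    simp only [proximity_const] at h2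
    linarith
  rw [← Finset.mul_sum] at hterm
  linarith

lemma differentiableAt_and_logDeriv_ratProd (s : Finset ℂ) (d : ℂ → ℤ) {z : ℂ} (hz : z ∉ s) :
    DifferentiableAt ℂ (ratProd s d) z ∧
      logDeriv (ratProd s d) z = ∑ u ∈ s, (d u : ℂ) / (z - u) := by
  have hne (u : ℂ) (hu : u ∈ s) : z - u ≠ 0 := sub_ne_zero.2 fun h ↦ hz (h ▸ hu)
  have hda (u : ℂ) (hu : u ∈ s) : DifferentiableAt ℂ ((fun z : ℂ ↦ z - u) ^ d u) z := by
    exact (differentiableAt_id.sub_const u).zpow (Or.inl (hne u hu))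
  have e : ratProd s d = fun z ↦ ∏ u ∈ s, ((fun z : ℂ ↦ z - u) ^ d u) z := by
    ext z; simp [ratProd, Finset.prod_apply]
  constructor
  · rw [e]
    exact DifferentiableAt.fun_finsetProd hda
  · rw [e, logDeriv_prod (f := fun u ↦ (fun z : ℂ ↦ z - u) ^ d u)
      (fun u hu ↦ zpow_ne_zero _ (hne u hu)) hda]
    refine Finset.sum_congr rfl fun u hu ↦ ?_
    have h1 := logDeriv_fun_zpow (f := fun z : ℂ ↦ z - u) (x := z) (by fun_prop) (d u)
    have h2 : ((fun z : ℂ ↦ z - u) ^ d u) = fun z : ℂ ↦ (z - u) ^ d u := rfl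
    rw [h2, h1, logDeriv_apply]
    simp [div_eq_mul_inv]

/-! ### Factorization on a disc and zero-free factors -/

/-- On a disc, a meromorphic function is a rational function times a zero-free holomorphic factor.
The factor is meromorphic on the whole plane, so that the identity holds globally. -/
lemma exists_ratProd_mul {f : ℂ → ℂ} (hf : Meromorphic f) (h0 : ∀ z, meromorphicOrderAt f z ≠ ⊤)
    (R : ℝ) :
    ∃ s : Finset ℂ, ∃ g : ℂ → ℂ, (∀ u, u ∈ s ↔ ‖u‖ ≤ R ∧ divisor f univ u ≠ 0) ∧
      Meromorphic g ∧ AnalyticOnNhd ℂ g (closedBall 0 R) ∧ (∀ z ∈ closedBall 0 R, g z ≠ 0) ∧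
      g =ᶠ[codiscrete ℂ] f * (ratProd s (divisor f univ))⁻¹ ∧
      f =ᶠ[codiscrete ℂ] ratProd s (divisor f univ) * g := by
  have hfin : {u | ‖u‖ ≤ R ∧ divisor f univ u ≠ 0}.Finite := by
    have h := (divisor f (closedBall 0 R)).finiteSupport (isCompact_closedBall 0 R)
    refine h.subset fun u hu ↦ ?_
    have hu' : u ∈ closedBall (0 : ℂ) R := by simpa using hu.1
    rw [Function.mem_support, divisor_apply hf.meromorphicOn hu']
    have := hu.2
    rwa [divisor_apply hf.meromorphicOn (mem_univ u)] at this
  set s := hfin.toFinset with hs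
  have hmem (u : ℂ) : u ∈ s ↔ ‖u‖ ≤ R ∧ divisor f univ u ≠ 0 := by simp [hs]
  set d : ℂ → ℤ := ⇑(divisor f univ) with hd
  have hP := meromorphic_ratProd s d
  have hq : Meromorphic (f * (ratProd s d)⁻¹) := hf.mul hP.inv
  have hq' : MeromorphicOn (f * (ratProd s d)⁻¹) univ := hq.meromorphicOn
  set g := toMeromorphicNFOn (f * (ratProd s d)⁻¹) univ with hg
  have hgNF : MeromorphicNFOn g univ := meromorphicNFOn_toMeromorphicNFOn _ _
  have hgq : g =ᶠ[codiscrete ℂ] f * (ratProd s d)⁻¹ := (toMeromorphicNFOn_eqOn_codiscrete hq').symm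
  have hord (z : ℂ) (hz : z ∈ closedBall 0 R) : meromorphicOrderAt g z = 0 := by
    rw [hg, meromorphicOrderAt_toMeromorphicNFOn hq' (mem_univ z),
      meromorphicOrderAt_mul (hf z) (hP.inv z), meromorphicOrderAt_inv]
    have e : ratProd s d = ∏ᶠ u, (fun z : ℂ ↦ z - u) ^ (if u ∈ s then d u else 0) := by
      rw [finprod_eq_prod_of_mulSupport_subset (s := s)]
      · exact Finset.prod_congr rfl fun u hu ↦ by simp [hu]
      · intro u hu
        by_contra h
        have h' : u ∉ s := by simpa using h
        simp [h'] at hu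
    rw [e, Function.FactorizedRational.meromorphicOrderAt_eq (fun u ↦ if u ∈ s then d u else 0)
      (s.finite_toSet.subset fun u hu ↦ by
        by_contra h
        have h' : u ∉ s := by simpa using h
        simp [h'] at hu)]
    have hdz : (if z ∈ s then d z else 0) = d z := by
      split_ifs with h
      · rfl
      · have h' : ‖z‖ ≤ R := by simpa using hz
        by_contra h2
        exact h ((hmem z).2 ⟨h', fun h3 ↦ h2 h3.symm⟩)
    rw [hdz, hd, divisor_apply hf.meromorphicOn (mem_univ z)]
    lift meromorphicOrderAt f z to ℤ using h0 z with k
    simp only [WithTop.untop₀_coe]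
    norm_cast
    simp
  refine ⟨s, g, hmem, hgNF.meromorphicOn |> meromorphicOn_univ.1, fun z hz ↦ ?_, fun z hz ↦ ?_,
    hgq, ?_⟩
  · exact (hgNF (mem_univ z)).meromorphicOrderAt_nonneg_iff_analyticAt.1 (hord z hz).ge
  · exact (hgNF (mem_univ z)).meromorphicOrderAt_eq_zero_iff.1 (hord z hz)
  · filter_upwards [hgq, s.finite_toSet.compl_mem_codiscrete] with z hz hzs
    have := ratProd_ne_zero s d hzs
    simp only [Pi.mul_apply, hz, Pi.inv_apply]
    field_simp

/-- The number of points of a non-negative divisor in the disc of radius `R`, times `log R`, is at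
most the logarithmic counting function at `R ^ 2`. -/
lemma sum_mul_log_le_logCounting {D : Function.locallyFinsupp ℂ ℤ} (hD : 0 ≤ D) (s : Finset ℂ)
    {R : ℝ} (hR : 1 ≤ R) (hs : ∀ u ∈ s, ‖u‖ ≤ R) :
    (∑ u ∈ s, (D u : ℝ)) * Real.log R ≤ Function.locallyFinsuppWithin.logCounting D (R ^ 2) := by
  classical
  have hD0 (u : ℂ) : 0 ≤ D u := hD u
  have hR2 : R ≤ R ^ 2 := by nlinarith
  have hle : ∑ u ∈ s, Function.locallyFinsuppWithin.single u (D u) ≤ D := by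
    intro z
    rw [Function.locallyFinsuppWithin.coe_sum, Finset.sum_apply]
    simp only [Function.locallyFinsuppWithin.single_apply]
    rw [Finset.sum_ite_eq]
    split_ifs
    · exact le_rfl
    · exact hD0 z
  refine le_trans ?_ (Function.locallyFinsuppWithin.logCounting_le hle (by nlinarith))
  rw [map_sum, Finset.sum_apply, Finset.sum_mul]
  refine Finset.sum_le_sum fun u hu ↦ ?_
  rw [Function.locallyFinsuppWithin.logCounting_single_eq_log_sub_const ((hs u hu).trans hR2)]
  have hD1 : (0 : ℝ) ≤ D u := by exact_mod_cast hD0 u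
  have hlog : Real.log (R ^ 2) = 2 * Real.log R := by simp
  have h0 := Real.log_nonneg hR
  refine mul_le_mul_of_nonneg_left ?_ hD1
  rcases eq_or_ne u 0 with rfl | h
  · simp; linarith
  · have := Real.log_le_log (norm_pos_iff.2 h) (hs u hu)
    linarith

lemma sum_abs_divisor_mul_log_le (f : ℂ → ℂ) (s : Finset ℂ)
    {R : ℝ} (hR : 1 ≤ R) (hs : ∀ u ∈ s, ‖u‖ ≤ R) :
    (∑ u ∈ s, |(divisor f univ u : ℝ)|) * Real.log R ≤
      characteristic f ⊤ (R ^ 2) + characteristic f⁻¹ ⊤ (R ^ 2) := by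
  have hR2 : 1 ≤ R ^ 2 := by nlinarith
  have h1 := sum_mul_log_le_logCounting (D := (divisor f univ)⁺) (posPart_nonneg _) s hR hs
  have h2 := sum_mul_log_le_logCounting (D := (divisor f univ)⁻) (negPart_nonneg _) s hR hs
  have e : ∑ u ∈ s, |(divisor f univ u : ℝ)| =
      ∑ u ∈ s, (((divisor f univ)⁺ u : ℤ) : ℝ) + ∑ u ∈ s, (((divisor f univ)⁻ u : ℤ) : ℝ) := by
    rw [← Finset.sum_add_distrib]
    refine Finset.sum_congr rfl fun u _ ↦ ?_
    have : |divisor f univ u| = (divisor f univ)⁺ u + (divisor f univ)⁻ u := by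
      simp [posPart_add_negPart]
    exact_mod_cast this
  rw [e, add_mul]
  have h3 : logCounting f ⊤ (R ^ 2) ≤ characteristic f ⊤ (R ^ 2) := by
    have : 0 ≤ proximity f ⊤ (R ^ 2) := proximity_nonneg _
    simp [characteristic, this]
  have h4 : logCounting f⁻¹ ⊤ (R ^ 2) ≤ characteristic f⁻¹ ⊤ (R ^ 2) := by
    have : 0 ≤ proximity f⁻¹ ⊤ (R ^ 2) := proximity_nonneg _
    simp [characteristic, this]
  rw [logCounting_inv] at h4
  rw [logCounting_zero] at h4
  rw [logCounting_top] at h3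
  linarith

lemma norm_circleAverage_le {f : ℂ → ℂ} {u : ℂ → ℝ} {R : ℝ} (hu : CircleIntegrable u 0 R)
    (h : ∀ z, ‖z‖ = |R| → ‖f z‖ ≤ u z) :
    ‖Real.circleAverage f 0 R‖ ≤ Real.circleAverage u 0 R := by
  rw [Real.circleAverage_def, Real.circleAverage_def, norm_smul, smul_eq_mul,
    Real.norm_of_nonneg (by positivity)]
  gcongr
  refine intervalIntegral.norm_integral_le_of_norm_le (by positivity) ?_ hu
  exact Eventually.of_forall fun θ _ ↦ h _ (by simp)

/-- The circle average of `|log |g||` is the sum of two proximity functions. -/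
lemma circleAverage_abs_log_norm {g : ℂ → ℂ} (hg : Meromorphic g) (R : ℝ) :
    Real.circleAverage (fun z ↦ |Real.log ‖g z‖|) 0 R = proximity g ⊤ R + proximity g⁻¹ ⊤ R := by
  rw [proximity_top, proximity_top,
    ← Real.circleAverage_add (circleIntegrable_posLog hg R) (circleIntegrable_posLog hg.inv R)]
  congr 1
  ext z
  simp only [Pi.add_apply, Pi.inv_apply, norm_inv, Real.posLog_apply, Real.log_inv]
  rcases le_total 0 (Real.log ‖g z‖) with h | h
  · rw [abs_of_nonneg h, max_eq_right h, max_eq_left (by linarith)]; ring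
  · rw [abs_of_nonpos h, max_eq_left h, max_eq_right (by linarith)]; ring

/-- A zero-free holomorphic function on the closed disc of radius `R` is, up to a constant factor,
the exponential of the Herglotz integral of `log |g|`.  The derivative of this integral is
controlled on the disc of half the radius by the mean of `|log |g||`. -/
lemma exists_exp_representation {g : ℂ → ℂ} (hgm : Meromorphic g) {R : ℝ} (hR : 0 < R)
    (hg : AnalyticOnNhd ℂ g (closedBall 0 R)) (h0 : ∀ z ∈ closedBall 0 R, g z ≠ 0) :
    ∃ G G' : ℂ → ℂ, ∃ k : ℂ, k ≠ 0 ∧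
      (∀ w ∈ ball (0 : ℂ) R, g w = k * Complex.exp (G w)) ∧
      (∀ w ∈ ball (0 : ℂ) R, HasDerivAt G (G' w) w) ∧
      ∀ w ∈ ball (0 : ℂ) (R / 2), ‖G' w‖ ≤ 8 / R * (proximity g ⊤ R + proximity g⁻¹ ⊤ R) := by
  set u : ℂ → ℝ := fun z ↦ Real.log ‖g z‖ with hu
  have hui : CircleIntegrable u 0 R := hgm.meromorphicOn.circleIntegrable_log_norm
  have hui' : CircleIntegrable (fun z ↦ (u z : ℂ)) 0 R := by
    simp only [CircleIntegrable, intervalIntegrable_iff] at hui ⊢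
    exact Complex.ofRealCLM.integrable_comp hui
  have hharm : InnerProductSpace.HarmonicOnNhd u (closedBall 0 R) := fun x hx ↦
    (hg x hx).harmonicAt_log_norm (h0 x hx)
  set G : ℂ → ℂ := fun w ↦
    Real.circleAverage (fun ζ ↦ herglotzRieszKernel 0 w ζ • (u ζ : ℂ)) 0 R with hG
  set G' : ℂ → ℂ := fun w ↦
    Real.circleAverage (fun ζ ↦ (2 * ζ / (ζ - w) ^ 2) • (u ζ : ℂ)) 0 R with hG'
  have hder (w : ℂ) (hw : w ∈ ball (0 : ℂ) R) : HasDerivAt G (G' w) w :=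
    hasDerivAt_circleAverage_herglotzRieszKernel_smul hui' hw
  have hre (w : ℂ) (hw : w ∈ ball (0 : ℂ) R) : (G w).re = u w := by
    rw [hG]
    simp only
    rw [re_circleAverage_herglotzRieszKernel_smul hui hw]
    exact hharm.circleAverage_re_herglotzRieszKernel_smul hw
  set q : ℂ → ℂ := fun w ↦ g w * Complex.exp (-G w) with hq
  have hqd : DifferentiableOn ℂ q (ball 0 R) := fun w hw ↦
    (((hg w (ball_subset_closedBall hw)).differentiableAt.mul
      (hder w hw).differentiableAt.neg.cexp)).differentiableWithinAt
  have hqn (w : ℂ) (hw : w ∈ ball (0 : ℂ) R) : ‖q w‖ = 1 := by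
    have hne : 0 < ‖g w‖ := norm_pos_iff.2 (h0 w (ball_subset_closedBall hw))
    rw [hq]
    simp only [norm_mul, Complex.norm_exp, Complex.neg_re, hre w hw, hu, Real.exp_neg,
      Real.exp_log hne]
    exact mul_inv_cancel₀ hne.ne'
  have h00 : (0 : ℂ) ∈ ball (0 : ℂ) R := mem_ball_self hR
  have hconst : EqOn q (Function.const ℂ (q 0)) (ball 0 R) :=
    Complex.eqOn_of_isPreconnected_of_isMaxOn_norm (convex_ball (0 : ℂ) R).isPreconnected
      isOpen_ball hqd h00 fun w hw ↦ by
        simp [hqn w hw, hqn 0 h00]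
  refine ⟨G, G', q 0, ?_, fun w hw ↦ ?_, hder, fun w hw ↦ ?_⟩
  · rw [← norm_pos_iff, hqn 0 h00]; exact one_pos
  · have := hconst hw
    simp only [Function.const_apply] at this
    rw [← this, hq]
    simp only
    rw [mul_assoc, ← Complex.exp_add]
    simp
  · have hw' : ‖w‖ < R / 2 := by simpa using hw
    rw [← circleAverage_abs_log_norm hgm R, ← smul_eq_mul, ← Real.circleAverage_fun_smul]
    refine norm_circleAverage_le (hui.abs.const_smul) fun z hz ↦ ?_
    rw [abs_of_pos hR] at hz
    have h1 : R / 2 ≤ ‖z - w‖ := by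
      have := norm_sub_norm_le z w
      linarith
    rw [norm_smul, smul_eq_mul, Complex.norm_real, Real.norm_eq_abs]
    refine mul_le_mul_of_nonneg_right ?_ (abs_nonneg _)
    rw [norm_div, norm_mul, norm_pow, hz, Complex.norm_ofNat]
    have h3 : 0 < ‖z - w‖ := by linarith
    rw [div_le_div_iff₀ (by positivity) hR]
    have h2 : (R / 2) ^ 2 ≤ ‖z - w‖ ^ 2 := by gcongr
    nlinarith

/-! ### Quotients of translates and logarithmic derivatives -/

/-- The data used to estimate quotients of translates and derivatives: a factorization on the disc
of radius `R` whose rational part has few factors and whose zero-free part has a small logarithmic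
derivative on the disc of radius `R / 2`, both measured by the characteristic functions of `f` and
`f⁻¹` at `R ^ 2`. It is applied on circles of radius `r` with `R = 4 * r`. -/
lemma exists_controlled_factorization {f : ℂ → ℂ} (hf : Meromorphic f)
    (h0 : ∀ z, meromorphicOrderAt f z ≠ ⊤) {R Q : ℝ} (hR : 4 ≤ R)
    (hQ : Q = (characteristic f ⊤ (R ^ 2) + characteristic f⁻¹ ⊤ (R ^ 2)) / Real.log R) :
    ∃ (s : Finset ℂ) (d : ℂ → ℤ) (g G G' : ℂ → ℂ) (k : ℂ),
      (∀ u ∈ s, d u ≠ 0) ∧ ∑ u ∈ s, |(d u : ℝ)| ≤ Q ∧ Meromorphic g ∧ k ≠ 0 ∧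
      f =ᶠ[codiscrete ℂ] ratProd s d * g ∧
      (∀ w ∈ ball (0 : ℂ) R, g w = k * Complex.exp (G w)) ∧
      (∀ w ∈ ball (0 : ℂ) R, HasDerivAt G (G' w) w) ∧
      ∀ w ∈ ball (0 : ℂ) (R / 2), ‖G' w‖ ≤ 40 * Q := by
  obtain ⟨s, g, hs, hgm, hg, hg0, hgf, hfg⟩ := exists_ratProd_mul hf h0 R
  set d : ℂ → ℤ := ⇑(divisor f univ) with hd
  have hR1 : 1 ≤ R := by linarith
  have hRpos : 0 < R := by linarith
  obtain ⟨G, G', k, hk, h1, h2, h3⟩ := exists_exp_representation hgm hRpos hg hg0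
  have hlog2 : Real.log 2 ≤ Real.log R := Real.log_le_log (by norm_num) (by linarith)
  have hlog : 0 < Real.log R := Real.log_pos (by linarith)
  set S := characteristic f ⊤ (R ^ 2) + characteristic f⁻¹ ⊤ (R ^ 2) with hS
  have hN := sum_abs_divisor_mul_log_le f s hR1 fun u hu ↦ ((hs u).1 hu).1
  rw [← hS] at hN
  set N := ∑ u ∈ s, |(d u : ℝ)| with hNdef
  have hN0 : 0 ≤ N := Finset.sum_nonneg fun u _ ↦ abs_nonneg _
  have hmono (φ : ℂ → ℂ) (hφ : Meromorphic φ) :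
      proximity φ ⊤ R ≤ characteristic φ ⊤ (R ^ 2) :=
    (proximity_le_characteristic φ hR1).trans
      (characteristic_monotoneOn hφ hRpos (by simp; positivity) (by nlinarith))
  have hB : proximity g ⊤ R + proximity g⁻¹ ⊤ R ≤ 5 * S := by
    have hgf' : g⁻¹ =ᶠ[codiscrete ℂ] f⁻¹ * ratProd s d := by
      filter_upwards [hgf] with z hz
      simp only [Pi.inv_apply, hz, Pi.mul_apply, mul_inv, inv_inv]
    have hP := meromorphic_ratProd s d
    have e1 := proximity_mul_le hf hP.inv R
    have e2 := proximity_mul_le hf.inv hP R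
    have e3 := proximity_ratProd_le s d hR1 fun u hu ↦ ((hs u).1 hu).1
    have e4 := proximity_ratProd_le s (fun u ↦ -d u) hR1 fun u hu ↦ ((hs u).1 hu).1
    rw [← ratProd_inv] at e4
    simp only [Int.cast_neg, abs_neg] at e4
    rw [← hNdef] at e3 e4
    rw [proximity_congr hgf hR1, proximity_congr hgf' hR1]
    have e5 := hmono f hf
    have e6 := hmono f⁻¹ hf.inv
    nlinarith
  have hNQ : N ≤ Q := by rwa [hQ, le_div_iff₀ hlog]
  refine ⟨s, d, g, G, G', k, fun u hu ↦ ((hs u).1 hu).2, hNQ, hgm, hk, hfg, h1, h2,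
    fun w hw ↦ (h3 w hw).trans ?_⟩
  have hS0 : 0 ≤ S := (mul_nonneg hN0 hlog.le).trans hN
  have hRlog : Real.log R ≤ R := Real.log_le_self hRpos.le
  have hSR : S / R ≤ Q := by rw [hQ]; gcongr
  calc 8 / R * (proximity g ⊤ R + proximity g⁻¹ ⊤ R) ≤ 8 / R * (5 * S) := by gcongr
    _ = 40 * (S / R) := by ring
    _ ≤ 40 * Q := by gcongr

lemma add_mem_ball_of_norm_eq {z c : ℂ} {r : ℝ} (hz : ‖z‖ = r) (hc : ‖c‖ < r) :
    z + c ∈ ball (0 : ℂ) (4 * r / 2) := by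
  have := norm_add_le z c
  rw [mem_ball_zero_iff]
  linarith

/-- Difference version of the lemma on the logarithmic derivative, with an error term proportional
to the number of zeros and poles in a larger disc. -/
lemma proximity_translate_quotient_le {f : ℂ → ℂ} (hf : Meromorphic f)
    (h0 : ∀ z, meromorphicOrderAt f z ≠ ⊤) (c c' : ℂ) {r : ℝ} (hr : 1 ≤ r) (hc : ‖c‖ < r)
    (hc' : ‖c'‖ < r) :
    proximity (fun z ↦ f (z + c) / f (z + c')) ⊤ r ≤
      (2 * Real.log 2 + Real.posLog ‖c - c'‖ + 40 * ‖c - c'‖) *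
        ((characteristic f ⊤ ((4 * r) ^ 2) + characteristic f⁻¹ ⊤ ((4 * r) ^ 2)) /
          Real.log (4 * r)) := by
  set Q := (characteristic f ⊤ ((4 * r) ^ 2) + characteristic f⁻¹ ⊤ ((4 * r) ^ 2)) /
          Real.log (4 * r) with hQ
  obtain ⟨s, d, g, G, G', k, -, hN, hgm, hk, hfg, h1, h2, h3⟩ :=
    exists_controlled_factorization hf h0 (R := 4 * r) (by linarith) hQ
  have hsub : ball (0 : ℂ) (4 * r / 2) ⊆ ball 0 (4 * r) := ball_subset_ball (by linarith)
  have hQ0 : 0 ≤ Q := (Finset.sum_nonneg fun u _ ↦ abs_nonneg _).trans hN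
  have e : (fun z ↦ f (z + c) / f (z + c')) =ᶠ[codiscrete ℂ]
      (fun z ↦ ratProd s d (z + c) / ratProd s d (z + c')) * fun z ↦ g (z + c) / g (z + c') := by
    filter_upwards [eventuallyEq_comp_add hfg c, eventuallyEq_comp_add hfg c'] with z hz hz'
    simp only [hz, hz', Pi.mul_apply]
    rw [mul_div_mul_comm]
  have hP := meromorphic_ratProd s d
  have hm1 : Meromorphic (fun z ↦ ratProd s d (z + c) / ratProd s d (z + c')) :=
    (meromorphic_comp_add hP c).div (meromorphic_comp_add hP c')
  have hm2 : Meromorphic (fun z ↦ g (z + c) / g (z + c')) :=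
    (meromorphic_comp_add hgm c).div (meromorphic_comp_add hgm c')
  have hb : proximity (fun z ↦ g (z + c) / g (z + c')) ⊤ r ≤ 40 * ‖c - c'‖ * Q := by
    have hx : 0 ≤ 40 * ‖c - c'‖ * Q := by positivity
    have : Real.posLog (Real.exp (40 * ‖c - c'‖ * Q)) = 40 * ‖c - c'‖ * Q := by
      rw [Real.posLog_eq_log, Real.log_exp]
      rw [abs_of_pos (Real.exp_pos _)]
      exact Real.one_le_exp hx
    rw [← this]
    refine proximity_top_le_of_norm_le hm2 (by linarith) fun z hz ↦ ?_
    have hw := add_mem_ball_of_norm_eq hz hc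
    have hw' := add_mem_ball_of_norm_eq hz hc'
    have hG : ‖G (z + c) - G (z + c')‖ ≤ 40 * Q * ‖(z + c) - (z + c')‖ :=
      (convex_ball (0 : ℂ) (4 * r / 2)).norm_image_sub_le_of_norm_hasDerivWithin_le
        (fun w hw ↦ (h2 w (hsub hw)).hasDerivWithinAt) h3 hw' hw
    rw [add_sub_add_left_eq_sub] at hG
    rw [h1 _ (hsub hw), h1 _ (hsub hw'), mul_div_mul_left _ _ hk, ← Complex.exp_sub,
      Complex.norm_exp, Real.exp_le_exp]
    have := Complex.re_le_norm (G (z + c) - G (z + c'))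
    linarith
  rw [proximity_congr e hr]
  have h4 := proximity_mul_le hm1 hm2 r
  have h5 := proximity_ratProd_quotient_le s d c c' hr
  have h6 : 0 ≤ 2 * Real.log 2 + Real.posLog ‖c - c'‖ := by
    have := Real.log_nonneg one_le_two
    have := Real.posLog_nonneg (x := ‖c - c'‖)
    linarith
  have h7 := mul_le_mul_of_nonneg_right hN h6
  linarith

/-- A version of the lemma on the logarithmic derivative for a translate of `f`, with an error term
proportional to the number of zeros and poles in a larger disc. -/
lemma proximity_logDeriv_translate_le {f : ℂ → ℂ} (hf : Meromorphic f)
    (h0 : ∀ z, meromorphicOrderAt f z ≠ ⊤) (c : ℂ) {r : ℝ} (hr : 1 ≤ r) (hc : ‖c‖ < r) :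
    proximity (fun z ↦ deriv f (z + c) / f (z + c)) ⊤ r ≤
      43 * ((characteristic f ⊤ ((4 * r) ^ 2) + characteristic f⁻¹ ⊤ ((4 * r) ^ 2)) /
          Real.log (4 * r)) + 1 := by
  set Q := (characteristic f ⊤ ((4 * r) ^ 2) + characteristic f⁻¹ ⊤ ((4 * r) ^ 2)) /
          Real.log (4 * r) with hQ
  obtain ⟨s, d, g, G, G', k, hd, hN, hgm, hk, hfg, h1, h2, h3⟩ :=
    exists_controlled_factorization hf h0 (R := 4 * r) (by linarith) hQ
  have hsub : ball (0 : ℂ) (4 * r / 2) ⊆ ball 0 (4 * r) := ball_subset_ball (by linarith)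
  have hQ0 : 0 ≤ Q := (Finset.sum_nonneg fun u _ ↦ abs_nonneg _).trans hN
  have hgder (w : ℂ) (hw : w ∈ ball (0 : ℂ) (4 * r)) : logDeriv g w = G' w := by
    have hge : g =ᶠ[𝓝 w] fun w ↦ k * Complex.exp (G w) := by
      filter_upwards [isOpen_ball.mem_nhds hw] using h1
    have := ((h2 w hw).cexp.const_mul k)
    rw [logDeriv_apply, hge.deriv_eq, this.deriv, h1 w hw]
    field_simp [Complex.exp_ne_zero]
  have hord : ∀ z, meromorphicOrderAt g z ≠ ⊤ := by
    refine order_ne_top_of_not_eventuallyEq_zero hgm fun hg0 ↦ ?_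
    have hf0 : f =ᶠ[codiscrete ℂ] 0 := by
      filter_upwards [hfg, hg0] with z hz hz'
      simp [hz, hz']
    have hne := eventually_ne_zero_of_order_ne_top hf h0
    have hbot : (codiscrete ℂ) = ⊥ := by
      rw [← eventually_false_iff_eq_bot]
      filter_upwards [hf0, hne] with z h h' using h' h
    rw [← empty_mem_iff_bot, mem_codiscrete] at hbot
    have := hbot 0
    simp only [compl_empty, principal_univ, disjoint_top] at this
    exact NeBot.ne inferInstance this
  have hP := meromorphic_ratProd s d
  have e0 : (fun z ↦ deriv f z / f z) =ᶠ[codiscrete ℂ]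
      fun z ↦ (∑ u ∈ s, (d u : ℂ) / (z - u)) + logDeriv g z := by
    filter_upwards [hfg, eventuallyEq_deriv hfg, s.finite_toSet.compl_mem_codiscrete,
      eventually_ne_zero_of_order_ne_top hgm hord,
      (meromorphicOn_univ.2 hgm).analyticAt_mem_codiscreteWithin] with z hz hz' hzs hg0 hga
    rw [hz, hz', ← logDeriv_apply, ← (differentiableAt_and_logDeriv_ratProd s d hzs).2]
    exact logDeriv_mul (f := ratProd s d) (g := g) z (ratProd_ne_zero s d hzs) hg0
      (differentiableAt_and_logDeriv_ratProd s d hzs).1 (AnalyticAt.differentiableAt hga)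
  have hm1 : Meromorphic (fun z ↦ ∑ u ∈ s, (d u : ℂ) / (z + c - u)) := by
    refine Meromorphic.fun_sum fun u _ ↦ ?_
    intro x; fun_prop
  have hm2 : Meromorphic (fun z ↦ logDeriv g (z + c)) := meromorphic_comp_add hgm.logDeriv c
  have hb : proximity (fun z ↦ logDeriv g (z + c)) ⊤ r ≤ 40 * Q := by
    have h5 : Real.posLog (40 * Q) ≤ 40 * Q := by
      rw [Real.posLog_apply]
      exact max_le (by positivity) (Real.log_le_self (by positivity))
    refine le_trans (proximity_top_le_of_norm_le hm2 (by linarith) fun z hz ↦ ?_) h5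
    have hw := add_mem_ball_of_norm_eq hz hc
    rw [hgder _ (hsub hw)]
    exact h3 _ hw
  have h4 := proximity_add_le hm1 hm2 r
  have h5 := proximity_logDeriv_ratProd_le s d hd c hr
  have h6 := Real.log_two_lt_d9
  rw [proximity_congr (eventuallyEq_comp_add e0 c) hr]
  have e1 : (fun z ↦ (∑ u ∈ s, (d u : ℂ) / (z + c - u)) + logDeriv g (z + c)) =
    (fun z ↦ ∑ u ∈ s, (d u : ℂ) / (z + c - u)) + fun z ↦ logDeriv g (z + c) := rfl
  rw [e1]
  linarith

/-! ### Growth of derivatives -/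

lemma negPart_divisor_deriv_le {f : ℂ → ℂ} (hf : Meromorphic f) :
    (divisor (deriv f) univ)⁻ ≤ 2 • (divisor f univ)⁻ := by
  intro z
  have hd : divisor (deriv f) univ z = (meromorphicOrderAt (deriv f) z).untop₀ :=
    divisor_apply hf.deriv.meromorphicOn (mem_univ z)
  have hd' : divisor f univ z = (meromorphicOrderAt f z).untop₀ :=
    divisor_apply hf.meromorphicOn (mem_univ z)
  simp only [Function.locallyFinsuppWithin.negPart_apply, Function.locallyFinsuppWithin.coe_nsmul,
    Pi.smul_apply, nsmul_eq_mul, hd, hd', Nat.cast_ofNat]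
  rcases lt_or_ge (meromorphicOrderAt f z) 0 with h | h
  · lift meromorphicOrderAt f z to ℤ using (ne_top_of_lt h) with k hk
    have hk0 : k < 0 := by exact_mod_cast h
    have hne : (k : ℂ) ≠ 0 := by exact_mod_cast hk0.ne
    rw [meromorphicOrderAt_deriv_eq_sub_one hne hk.symm]
    have h1 : ((k - 1 : ℤ) : WithTop ℤ).untop₀ = k - 1 := WithTop.untop₀_coe _
    have h2 : (k : WithTop ℤ).untop₀ = k := WithTop.untop₀_coe k
    rw [h1, h2, negPart_def, negPart_def]
    rw [sup_eq_left.2 (by omega), sup_eq_left.2 (by omega)]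
    omega
  · have h1 : 0 ≤ meromorphicOrderAt (deriv f) z := by
      obtain ⟨φ, hφ, hfφ⟩ : ∃ φ, AnalyticAt ℂ φ z ∧ f =ᶠ[𝓝[≠] z] φ :=
        ⟨toMeromorphicNFAt f z,
          (hf z).meromorphicOrderAt_nonneg_iff_analyticAt_toMeromorphicNFAt.1 h,
          (hf z).eq_nhdsNE_toMeromorphicNFAt⟩
      rw [meromorphicOrderAt_congr hfφ.nhdsNE_deriv]
      exact hφ.deriv.meromorphicOrderAt_nonneg
    have h2 : 0 ≤ (meromorphicOrderAt (deriv f) z).untop₀ := WithTop.untop₀_nonneg.2 h1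
    rw [negPart_eq_zero.2 h2]
    positivity

lemma characteristic_deriv_le {f : ℂ → ℂ} (hf : Meromorphic f) {r : ℝ} (hr : 1 ≤ r) :
    characteristic (deriv f) ⊤ r ≤
      2 * characteristic f ⊤ r + proximity (fun z ↦ deriv f z / f z) ⊤ r := by
  by_cases h : f =ᶠ[codiscrete ℂ] 0
  · have h1 : deriv f =ᶠ[codiscrete ℂ] 0 := by
      have := eventuallyEq_deriv h
      simpa [Pi.zero_def] using this
    rw [characteristic_congr_codiscrete h1 (by positivity),
      characteristic_congr_codiscrete h (by positivity)]
    have h2 : 0 ≤ proximity (fun z ↦ deriv f z / f z) ⊤ r := proximity_nonneg _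
    have h3 : characteristic (0 : ℂ → ℂ) ⊤ r = 0 := by
      simp [characteristic, logCounting_top, proximity_zero_fun]
    rw [h3]; linarith
  have h0 := order_ne_top_of_not_eventuallyEq_zero hf h
  have hN : logCounting (deriv f) ⊤ r ≤ 2 * logCounting f ⊤ r := by
    rw [logCounting_top, logCounting_top]
    have := Function.locallyFinsuppWithin.logCounting_le (negPart_divisor_deriv_le hf) hr
    rw [map_nsmul] at this
    simpa using this
  have e : deriv f =ᶠ[codiscrete ℂ] (fun z ↦ deriv f z / f z) * f := by
    filter_upwards [eventually_ne_zero_of_order_ne_top hf h0] with z hz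
    simp only [Pi.mul_apply]; field_simp
  have hm := proximity_mul_le (hf.deriv.fun_div hf) hf r
  rw [← proximity_congr e hr] at hm
  have hp : 0 ≤ proximity f ⊤ r := proximity_nonneg _
  simp only [characteristic, Pi.add_apply]
  linarith

/-! ### Functions of finite logarithmic order -/

lemma isBigO_one_log_rpow {s : ℝ} (hs : 0 ≤ s) :
    (fun _ : ℝ ↦ (1 : ℝ)) =O[atTop] fun r ↦ Real.log r ^ s := by
  refine IsBigO.of_bound 1 ?_
  filter_upwards [Real.tendsto_log_atTop.eventually_ge_atTop 1] with r hr
  have h1 := Real.one_le_rpow hr hs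
  rw [one_mul, norm_one, Real.norm_of_nonneg (by positivity)]
  exact h1

lemma isBigO_log_four_mul_sq : (fun r : ℝ ↦ Real.log ((4 * r) ^ 2)) =O[atTop] Real.log := by
  refine IsBigO.of_bound 4 ?_
  filter_upwards [eventually_ge_atTop 4] with r hr
  have h1 : 0 ≤ Real.log r := Real.log_nonneg (by linarith)
  have h2 : Real.log ((4 * r) ^ 2) = 2 * (Real.log 4 + Real.log r) := by
    rw [Real.log_pow, Real.log_mul (by norm_num) (by positivity)]; simp
  have h3 : Real.log 4 ≤ Real.log r := Real.log_le_log (by norm_num) hr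
  have h4 : 0 ≤ Real.log 4 := Real.log_nonneg (by norm_num)
  rw [h2, Real.norm_of_nonneg (by linarith), Real.norm_of_nonneg h1]
  linarith

/-- The number of zeros and poles in a disc of radius `4 * r` grows slower than the characteristic
function by a factor `log r`, as seen on comparing with the counting function at `(4 * r) ^ 2`. -/
lemma isBigO_characteristic_div_log {f : ℂ → ℂ} (hf : Meromorphic f) {s : ℝ} (hs : 0 ≤ s)
    (hT : characteristic f ⊤ =O[atTop] fun r ↦ Real.log r ^ (s + 1)) :
    (fun r : ℝ ↦ (characteristic f ⊤ ((4 * r) ^ 2) + characteristic f⁻¹ ⊤ ((4 * r) ^ 2)) /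
          Real.log (4 * r)) =O[atTop] fun r ↦ Real.log r ^ s := by
  have hT' : characteristic f⁻¹ ⊤ =O[atTop] fun r ↦ Real.log r ^ (s + 1) := by
    have h1 := (isBigO_characteristic_sub_characteristic_inv hf).trans
      (isBigO_one_log_rpow (s := s + 1) (by linarith))
    simpa using hT.sub h1
  have ht : Tendsto (fun r : ℝ ↦ (4 * r) ^ 2) atTop atTop :=
    (tendsto_pow_atTop two_ne_zero).comp (tendsto_id.const_mul_atTop (by norm_num))
  have h1 := (hT.add hT').comp_tendsto ht
  have h2 : (fun r : ℝ ↦ Real.log ((4 * r) ^ 2) ^ (s + 1)) =O[atTop]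
      fun r ↦ Real.log r ^ (s + 1) :=
    isBigO_log_four_mul_sq.rpow (by linarith) (by
      filter_upwards [Real.tendsto_log_atTop.eventually_ge_atTop 0] using fun r hr ↦ hr)
  have h3 : (fun r : ℝ ↦ (Real.log (4 * r))⁻¹) =O[atTop] fun r ↦ (Real.log r)⁻¹ := by
    refine IsBigO.of_bound 1 ?_
    filter_upwards [eventually_gt_atTop 1] with r hr
    have h4 : 0 < Real.log r := Real.log_pos hr
    have h5 : Real.log r ≤ Real.log (4 * r) := Real.log_le_log (by linarith) (by linarith)
    rw [one_mul, Real.norm_of_nonneg (inv_nonneg.2 (h4.le.trans h5)),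
      Real.norm_of_nonneg (inv_nonneg.2 h4.le)]
    gcongr
  refine ((h1.trans h2).mul h3).congr' (Eventually.of_forall fun r ↦ ?_) ?_
  · simp [div_eq_mul_inv]
  · filter_upwards [Real.tendsto_log_atTop.eventually_gt_atTop 0] with r hr
    rw [Real.rpow_add_one hr.ne', mul_assoc, mul_inv_cancel₀ hr.ne', mul_one]

lemma isBigO_proximity_of_le {f : ℂ → ℂ} {b : ℝ → ℝ} {s : ℝ}
    (h : ∀ᶠ r in atTop, proximity f ⊤ r ≤ b r)
    (hb : b =O[atTop] fun r ↦ Real.log r ^ s) :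
    proximity f ⊤ =O[atTop] fun r ↦ Real.log r ^ s := by
  refine IsBigO.trans (IsBigO.of_bound 1 ?_) hb
  filter_upwards [h] with r hr
  have h0 : 0 ≤ proximity f ⊤ r := proximity_nonneg _
  rw [one_mul, Real.norm_of_nonneg h0, Real.norm_of_nonneg (h0.trans hr)]
  exact hr

lemma isBigO_proximity_of_eventuallyEq_zero {f : ℂ → ℂ} (h : f =ᶠ[codiscrete ℂ] 0) (s : ℝ) :
    proximity f ⊤ =O[atTop] fun r ↦ Real.log r ^ s := by
  refine isBigO_proximity_of_le (b := 0) ?_ (isBigO_zero _ _)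
  filter_upwards [eventually_ge_atTop 1] with r hr
  rw [proximity_congr h hr, proximity_zero_fun]
  simp

lemma isBigO_proximity_translate_quotient {f : ℂ → ℂ} (hf : Meromorphic f)
    (h0 : ∀ z, meromorphicOrderAt f z ≠ ⊤) {s : ℝ} (hs : 0 ≤ s)
    (hT : characteristic f ⊤ =O[atTop] fun r ↦ Real.log r ^ (s + 1)) (c c' : ℂ) :
    proximity (fun z ↦ f (z + c) / f (z + c')) ⊤ =O[atTop] fun r ↦ Real.log r ^ s := by
  refine isBigO_proximity_of_le ?_ ((isBigO_characteristic_div_log hf hs hT).const_mul_left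
    (2 * Real.log 2 + Real.posLog ‖c - c'‖ + 40 * ‖c - c'‖))
  filter_upwards [eventually_ge_atTop 1, eventually_gt_atTop ‖c‖, eventually_gt_atTop ‖c'‖]
    with r h1 h2 h3 using proximity_translate_quotient_le hf h0 c c' h1 h2 h3

lemma isBigO_proximity_logDeriv_translate {f : ℂ → ℂ} (hf : Meromorphic f)
    (h0 : ∀ z, meromorphicOrderAt f z ≠ ⊤) {s : ℝ} (hs : 0 ≤ s)
    (hT : characteristic f ⊤ =O[atTop] fun r ↦ Real.log r ^ (s + 1)) (c : ℂ) :
    proximity (fun z ↦ deriv f (z + c) / f (z + c)) ⊤ =O[atTop] fun r ↦ Real.log r ^ s := by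
  refine isBigO_proximity_of_le ?_
    (((isBigO_characteristic_div_log hf hs hT).const_mul_left 43).add (isBigO_one_log_rpow hs))
  filter_upwards [eventually_ge_atTop 1, eventually_gt_atTop ‖c‖]
    with r h1 h2 using proximity_logDeriv_translate_le hf h0 c h1 h2

lemma isBigO_characteristic_deriv {f : ℂ → ℂ} (hf : Meromorphic f)
    (h0 : ∀ z, meromorphicOrderAt f z ≠ ⊤) {s : ℝ} (hs : 0 ≤ s)
    (hT : characteristic f ⊤ =O[atTop] fun r ↦ Real.log r ^ (s + 1)) :
    characteristic (deriv f) ⊤ =O[atTop] fun r ↦ Real.log r ^ (s + 1) := by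
  have h1 := isBigO_proximity_logDeriv_translate hf h0 hs hT 0
  simp only [add_zero] at h1
  have h2 : (fun r ↦ Real.log r ^ s) =O[atTop] fun r ↦ Real.log r ^ (s + 1) := by
    refine IsBigO.of_bound 1 ?_
    filter_upwards [Real.tendsto_log_atTop.eventually_ge_atTop 1] with r hr
    rw [one_mul, Real.norm_of_nonneg (by positivity), Real.norm_of_nonneg (by positivity)]
    exact Real.rpow_le_rpow_of_exponent_le hr (by linarith)
  refine IsBigO.trans (IsBigO.of_bound 1 ?_) ((hT.const_mul_left 2).add (h1.trans h2))
  filter_upwards [eventually_ge_atTop 1] with r hr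
  have h3 := characteristic_deriv_le hf hr
  have h4 := characteristic_nonneg (f := deriv f) (a := ⊤) hr
  rw [one_mul, Real.norm_of_nonneg h4, Real.norm_of_nonneg (h4.trans h3)]
  exact h3

/-- If `T(r, f) = O((log r) ^ (s + 1))`, the proximity function of every quotient of a translated
derivative of `f` by a translate of `f` is `O((log r) ^ s)`. -/
theorem isBigO_proximity_iteratedDeriv_quotient {s : ℝ} (hs : 0 ≤ s) (j : ℕ) :
    ∀ {f : ℂ → ℂ}, Meromorphic f →
      (characteristic f ⊤ =O[atTop] fun r ↦ Real.log r ^ (s + 1)) → ∀ c c' : ℂ,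
      proximity (fun z ↦ iteratedDeriv j f (z + c) / f (z + c')) ⊤ =O[atTop]
        fun r ↦ Real.log r ^ s := by
  induction j with
  | zero =>
    intro f hf hT c c'
    by_cases h : f =ᶠ[codiscrete ℂ] 0
    · apply isBigO_proximity_of_eventuallyEq_zero
      filter_upwards [eventuallyEq_comp_add h c] with z hz
      simp [hz]
    · simpa using isBigO_proximity_translate_quotient hf
        (order_ne_top_of_not_eventuallyEq_zero hf h) hs hT c c'
  | succ j ih =>
    intro f hf hT c c'
    rw [iteratedDeriv_succ']
    by_cases h' : deriv f =ᶠ[codiscrete ℂ] 0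
    · apply isBigO_proximity_of_eventuallyEq_zero
      filter_upwards [eventuallyEq_comp_add (eventuallyEq_iteratedDeriv h' j) c] with z hz
      simp [hz, iteratedDeriv_const_zero]
    have h0' := order_ne_top_of_not_eventuallyEq_zero hf.deriv h'
    have h : ¬ f =ᶠ[codiscrete ℂ] 0 := fun h ↦ h' (by
      simpa [Pi.zero_def] using eventuallyEq_deriv h)
    have h0 := order_ne_top_of_not_eventuallyEq_zero hf h
    have h1 := ih hf.deriv (isBigO_characteristic_deriv hf h0 hs hT) c c'
    have h2 := isBigO_proximity_logDeriv_translate hf h0 hs hT c'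
    refine isBigO_proximity_of_le ?_ (h1.add h2)
    filter_upwards [eventually_ge_atTop 1] with r hr
    have e : (fun z ↦ iteratedDeriv j (deriv f) (z + c) / f (z + c')) =ᶠ[codiscrete ℂ]
        (fun z ↦ iteratedDeriv j (deriv f) (z + c) / deriv f (z + c')) *
          fun z ↦ deriv f (z + c') / f (z + c') := by
      filter_upwards [tendsto_add_const_codiscrete c' |>.eventually
        (eventually_ne_zero_of_order_ne_top hf.deriv h0')] with z hz
      simp only [Pi.mul_apply]
      field_simp
    rw [proximity_congr e hr]
    exact proximity_mul_le
      ((meromorphic_comp_add (meromorphic_iteratedDeriv hf.deriv j) c).fun_div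
        (meromorphic_comp_add hf.deriv c'))
      ((meromorphic_comp_add hf.deriv c').fun_div (meromorphic_comp_add hf c')) r

/-! ### The equation -/

lemma proximity_neg (f : ℂ → ℂ) : proximity (-f) ⊤ = proximity f ⊤ := by
  simp [proximity_top]

lemma insert_otherIndices {n m : ℕ} {a l : Fin (n + 1)} {b : Fin (m + 1)}
    (hab : (a, b) ≠ (l, 0)) :
    Finset.univ.erase (l, 0) = insert (a, b) (otherIndices a l b) := by
  ext p
  simp only [Finset.mem_erase, Finset.mem_univ, and_true, Finset.mem_insert, otherIndices,
    Finset.mem_filter, true_and]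
  constructor
  · intro h
    by_cases hp : p = (a, b)
    · exact Or.inl hp
    · exact Or.inr ⟨hp, h⟩
  · rintro (rfl | h)
    · exact hab
    · exact h.2

/-- Division of the equation by `f (z + c l)`. -/
lemma proximity_coefficient_le {n m : ℕ} {c : Fin (n + 1) → ℂ}
    {A : Fin (n + 1) → Fin (m + 1) → ℂ → ℂ} {F f : ℂ → ℂ} (hA : ∀ i j, Meromorphic (A i j))
    (hF : Meromorphic F) {a l : Fin (n + 1)} {b : Fin (m + 1)} (hab : (a, b) ≠ (l, 0))
    (hf : IsMeromorphicSolution c A F f) (h : ¬ f =ᶠ[codiscrete ℂ] 0) {s : ℝ} (hs : 0 ≤ s)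
    (hT : characteristic f ⊤ =O[atTop] fun r ↦ Real.log r ^ (s + 1))
    (hTF : F =ᶠ[codiscrete ℂ] 0 ∨ characteristic f ⊤ =O[atTop] fun r ↦ Real.log r ^ s) :
    ∃ E : ℝ → ℝ, (E =O[atTop] fun r ↦ Real.log r ^ s) ∧ ∀ᶠ r in atTop,
      proximity (A l 0) ⊤ r ≤ characteristic (A a b) ⊤ r +
        ((∑ p ∈ otherIndices a l b, characteristic (A p.1 p.2) ⊤ r) +
          (characteristic F ⊤ r + E r)) := by
  obtain ⟨hfm, heq⟩ := hf
  have h0 := order_ne_top_of_not_eventuallyEq_zero hfm h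
  set t := otherIndices a l b with ht
  have habt : (a, b) ∉ t := by simp [ht, otherIndices]
  set Q : Fin (n + 1) × Fin (m + 1) → ℂ → ℂ := fun p z ↦
    iteratedDeriv (p.2 : ℕ) f (z + c p.1) / f (z + c l) with hQ
  have hQm (p) : Meromorphic (Q p) :=
    (meromorphic_comp_add (meromorphic_iteratedDeriv hfm _) _).fun_div (meromorphic_comp_add hfm _)
  have hQO (p) : proximity (Q p) ⊤ =O[atTop] fun r ↦ Real.log r ^ s :=
    isBigO_proximity_iteratedDeriv_quotient hs _ hfm hT _ _
  -- The inhomogeneous term, divided by `f (z + c l)`.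
  set H : ℂ → ℂ := F * fun z ↦ (f (z + c l))⁻¹ with hH
  have hIm : Meromorphic fun z ↦ (f (z + c l))⁻¹ := (meromorphic_comp_add hfm _).fun_inv
  have hHm : Meromorphic H := hF.mul hIm
  obtain ⟨E0, hE0, hHle⟩ : ∃ E0 : ℝ → ℝ, (E0 =O[atTop] fun r ↦ Real.log r ^ s) ∧
      ∀ᶠ r in atTop, proximity H ⊤ r ≤ characteristic F ⊤ r + E0 r := by
    rcases hTF with hF0 | hTf
    · refine ⟨0, isBigO_zero _ _, ?_⟩
      filter_upwards [eventually_ge_atTop 1] with r hr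
      have hH0 : H =ᶠ[codiscrete ℂ] 0 := by
        filter_upwards [hF0] with z hz
        simp [hH, hz]
      rw [proximity_congr hH0 hr, proximity_zero_fun]
      simpa using characteristic_nonneg hr
    · have hTi : characteristic f⁻¹ ⊤ =O[atTop] fun r ↦ Real.log r ^ s := by
        simpa using hTf.sub ((isBigO_characteristic_sub_characteristic_inv hfm).trans
          (isBigO_one_log_rpow hs))
      refine ⟨_, hTi.add (isBigO_proximity_translate_quotient hfm h0 hs hT 0 (c l)), ?_⟩
      filter_upwards [eventually_ge_atTop 1] with r hr
      have e : (fun z ↦ (f (z + c l))⁻¹) =ᶠ[codiscrete ℂ]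
          f⁻¹ * fun z ↦ f (z + 0) / f (z + c l) := by
        filter_upwards [eventually_ne_zero_of_order_ne_top hfm h0] with z hz
        simp only [Pi.mul_apply, Pi.inv_apply, add_zero]
        field_simp
      have h1 := proximity_mul_le hF hIm r
      have h2 := proximity_mul_le hfm.inv
        ((meromorphic_comp_add hfm 0).fun_div (meromorphic_comp_add hfm (c l))) r
      rw [← proximity_congr e hr] at h2
      have h3 := proximity_le_characteristic F hr
      have h4 := proximity_le_characteristic f⁻¹ hr
      linarith
  have hid : A l 0 =ᶠ[codiscrete ℂ] H + -∑ p ∈ insert (a, b) t, A p.1 p.2 * Q p := by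
    filter_upwards [heq, (tendsto_add_const_codiscrete (c l)).eventually
      (eventually_ne_zero_of_order_ne_top hfm h0)] with z hz hz0
    have h1 : ∑ p : Fin (n + 1) × Fin (m + 1),
        A p.1 p.2 z * iteratedDeriv (p.2 : ℕ) f (z + c p.1) = F z := by
      rw [Fintype.sum_prod_type]; exact hz
    rw [← Finset.add_sum_erase _ _ (Finset.mem_univ (l, 0)), insert_otherIndices hab, ← ht] at h1
    simp only [Fin.val_zero, iteratedDeriv_zero] at h1
    simp only [Pi.add_apply, Pi.neg_apply, Finset.sum_apply, Pi.mul_apply, hH, hQ]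
    have h2 : ∑ p ∈ insert (a, b) t, A p.1 p.2 z *
        (iteratedDeriv (p.2 : ℕ) f (z + c p.1) / f (z + c l)) =
        (∑ p ∈ insert (a, b) t, A p.1 p.2 z * iteratedDeriv (p.2 : ℕ) f (z + c p.1)) /
          f (z + c l) := by
      rw [Finset.sum_div]
      exact Finset.sum_congr rfl fun p _ ↦ by ring
    rw [h2, ← h1]
    field_simp
    ring
  refine ⟨fun r ↦ E0 r + ((∑ p ∈ insert (a, b) t, proximity (Q p) ⊤) r +
    (Real.log (insert (a, b) t).card + Real.log 2) * 1), ?_, ?_⟩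
  · exact hE0.add ((IsBigO.sum fun p _ ↦ hQO p).add ((isBigO_one_log_rpow hs).const_mul_left _))
  · filter_upwards [hHle, eventually_ge_atTop 1] with r hr hr1
    rw [proximity_congr hid hr1]
    have hm (p : Fin (n + 1) × Fin (m + 1)) : Meromorphic (A p.1 p.2 * Q p) :=
      (hA _ _).mul (hQm p)
    have h1 := proximity_add_le hHm
      (Meromorphic.sum (s := insert (a, b) t) fun p _ ↦ hm p).neg r
    rw [proximity_neg] at h1
    have h2 := proximity_sum_top_le (insert (a, b) t) (fun p ↦ A p.1 p.2 * Q p)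
      (fun p _ ↦ hm p) r
    simp only [Pi.add_apply, Finset.sum_apply] at h2
    have h3 : ∑ p ∈ insert (a, b) t, proximity (A p.1 p.2 * Q p) ⊤ r ≤
        ∑ p ∈ insert (a, b) t, (characteristic (A p.1 p.2) ⊤ r + proximity (Q p) ⊤ r) :=
      Finset.sum_le_sum fun p _ ↦ (proximity_mul_le (hA _ _) (hQm p) r).trans
        (add_le_add_left (proximity_le_characteristic _ hr1) _)
    rw [Finset.sum_add_distrib,
      Finset.sum_insert (f := fun p ↦ characteristic (A p.1 p.2) ⊤ r) habt] at h3
    rw [Finset.sum_apply]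
    linarith

/-! ### Comparison with powers of the logarithm -/

lemma characteristic_le_log_rpow {T r e : ℝ} (hT : 0 ≤ T) (hr : 1 < Real.log r)
    (h : Real.log T / Real.log (Real.log r) ≤ e) : T ≤ Real.log r ^ e := by
  rcases hT.eq_or_lt with rfl | hT
  · positivity
  · rw [div_le_iff₀ (Real.log_pos hr)] at h
    rw [Real.rpow_def_of_pos (by linarith), ← Real.log_le_iff_le_exp hT]
    linarith

lemma log_rpow_le_characteristic {T r e : ℝ} (hT : 0 ≤ T) (hr : 1 < Real.log r) (he : 0 ≤ e)
    (h : e < Real.log T / Real.log (Real.log r)) : Real.log r ^ e ≤ T := by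
  have hl := Real.log_pos hr
  rw [lt_div_iff₀ hl] at h
  -- `T = 0` is excluded because then `log T = 0` in Mathlib's convention.
  have hT' : 0 < T := hT.lt_of_ne' fun h0 ↦ by
    rw [h0, Real.log_zero] at h
    have := mul_nonneg he hl.le
    linarith
  rw [Real.rpow_def_of_pos (by linarith), ← Real.le_log_iff_exp_le hT']
  linarith

lemma eventually_one_lt_log : ∀ᶠ r : ℝ in atTop, 1 ≤ r ∧ 1 < Real.log r :=
  (eventually_ge_atTop 1).and (Real.tendsto_log_atTop.eventually_gt_atTop 1)

lemma eventually_characteristic_le {g : ℂ → ℂ} {e : ℝ} (h : logOrder g < e) :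
    ∀ᶠ r in atTop, characteristic g ⊤ r ≤ Real.log r ^ e := by
  filter_upwards [eventually_lt_of_limsup_lt h, eventually_one_lt_log] with r hr hr1
  exact characteristic_le_log_rpow (characteristic_nonneg hr1.1) hr1.2
    (EReal.coe_lt_coe_iff.1 hr).le

lemma frequently_characteristic_le {g : ℂ → ℂ} {e : ℝ} (h : logLowerOrder g < e) :
    ∃ᶠ r in atTop, characteristic g ⊤ r ≤ Real.log r ^ e := by
  refine ((frequently_lt_of_liminf_lt (by isBoundedDefault) h).and_eventually
    eventually_one_lt_log).mono fun r hr ↦ ?_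
  exact characteristic_le_log_rpow (characteristic_nonneg hr.2.1) hr.2.2
    (EReal.coe_lt_coe_iff.1 hr.1).le

lemma eventually_le_characteristic {g : ℂ → ℂ} {e : ℝ} (he : 0 ≤ e) (h : e < logLowerOrder g) :
    ∀ᶠ r in atTop, Real.log r ^ e ≤ characteristic g ⊤ r := by
  filter_upwards [eventually_lt_of_lt_liminf h, eventually_one_lt_log] with r hr hr1
  exact log_rpow_le_characteristic (characteristic_nonneg hr1.1) hr1.2 he
    (EReal.coe_lt_coe_iff.1 hr)

lemma isBigO_characteristic_of_logOrder_lt {g : ℂ → ℂ} {e : ℝ} (h : logOrder g < e) :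
    characteristic g ⊤ =O[atTop] fun r ↦ Real.log r ^ e := by
  refine IsBigO.of_bound 1 ?_
  filter_upwards [eventually_characteristic_le h, eventually_one_lt_log] with r hr hr1
  rw [one_mul, Real.norm_of_nonneg (characteristic_nonneg hr1.1),
    Real.norm_of_nonneg (by have := hr1.2; positivity)]
  exact hr

/-- `φ (r) / (log r) ^ e` as an extended non-negative real number. -/
noncomputable def logRatio (φ : ℝ → ℝ) (e : ℝ) (r : ℝ) : ℝ≥0∞ :=
  ENNReal.ofReal (φ r / Real.log r ^ e)

lemma tendsto_log_rpow_div {s e : ℝ} (h : s < e) :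
    Tendsto (fun r : ℝ ↦ Real.log r ^ s / Real.log r ^ e) atTop (𝓝 0) := by
  refine ((tendsto_rpow_neg_atTop (sub_pos.2 h)).comp Real.tendsto_log_atTop).congr' ?_
  filter_upwards [Real.tendsto_log_atTop.eventually_gt_atTop 0] with r hr
  rw [← Real.rpow_sub hr]
  simp

lemma tendsto_logRatio_of_isBigO {φ : ℝ → ℝ} {s e : ℝ} (h : s < e)
    (hφ : φ =O[atTop] fun r ↦ Real.log r ^ s) : Tendsto (logRatio φ e) atTop (𝓝 0) := by
  have h1 : Tendsto (fun r ↦ φ r / Real.log r ^ e) atTop (𝓝 0) :=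
    (hφ.mul (isBigO_refl (fun r : ℝ ↦ (Real.log r ^ e)⁻¹) atTop)).trans_tendsto
      (tendsto_log_rpow_div h)
  have h2 := ENNReal.tendsto_ofReal h1
  rwa [ENNReal.ofReal_zero] at h2

lemma limsup_logRatio_eq_zero {g : ℂ → ℂ} {e : ℝ} (h : logOrder g < e) :
    limsup (logRatio (characteristic g ⊤) e) atTop = 0 := by
  obtain ⟨q, hq, hqe⟩ := EReal.lt_iff_exists_real_btwn.1 h
  exact (tendsto_logRatio_of_isBigO (EReal.coe_lt_coe_iff.1 hqe)
    (isBigO_characteristic_of_logOrder_lt hq)).limsup_eq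

lemma liminf_logRatio_eq_zero {g : ℂ → ℂ} {e : ℝ} (h : logLowerOrder g < e) :
    liminf (logRatio (characteristic g ⊤) e) atTop = 0 := by
  obtain ⟨q, hq, hqe⟩ := EReal.lt_iff_exists_real_btwn.1 h
  have ht : Tendsto (logRatio (fun r ↦ Real.log r ^ q) e) atTop (𝓝 0) :=
    tendsto_logRatio_of_isBigO (EReal.coe_lt_coe_iff.1 hqe) (isBigO_refl _ _)
  refine le_antisymm (le_of_forall_gt fun ε hε ↦ ?_) zero_le
  obtain ⟨ε', hε', hεε'⟩ := exists_between hε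
  refine lt_of_le_of_lt (liminf_le_of_frequently_le' ?_) hεε'
  refine ((frequently_characteristic_le hq).and_eventually
    ((ht.eventually_lt_const hε').and eventually_one_lt_log)).mono fun r hr ↦ ?_
  refine le_trans ?_ hr.2.1.le
  have := hr.2.2.2
  exact ENNReal.ofReal_le_ofReal (div_le_div_of_nonneg_right hr.1 (by positivity))

lemma one_le_liminf_logRatio {g : ℂ → ℂ} {e : ℝ} (he : 0 ≤ e) (h : e < logLowerOrder g) :
    1 ≤ liminf (logRatio (characteristic g ⊤) e) atTop := by
  refine le_liminf_of_le (by isBoundedDefault) ?_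
  filter_upwards [eventually_le_characteristic he h, eventually_one_lt_log] with r hr hr1
  have h0 := hr1.2
  rw [logRatio, ENNReal.one_le_ofReal, le_div_iff₀ (by positivity)]
  linarith

lemma limsup_logRatio_eq_logType {g : ℂ → ℂ} {e : ℝ} (h : logOrder g = e) :
    limsup (logRatio (characteristic g ⊤) e) atTop = logType g := by
  rw [logType, h]; rfl

lemma liminf_logRatio_eq_logLowerType {g : ℂ → ℂ} {e : ℝ} (h : logLowerOrder g = e) :
    liminf (logRatio (characteristic g ⊤) e) atTop = logLowerType g := by
  rw [logLowerType, h]; rfl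

/-! ### Lower and upper limits of sums -/

lemma liminf_add_le_liminf_add_limsup {u w : ℝ → ℝ≥0∞} :
    liminf (fun r ↦ u r + w r) atTop ≤ liminf u atTop + limsup w atTop := by
  refine ENNReal.le_of_forall_pos_le_add fun ε hε hfin ↦ ?_
  rw [ENNReal.add_lt_top] at hfin
  have hε' : (0 : ℝ≥0∞) < ε / 2 := by simpa using hε.ne'
  have h1 := frequently_lt_of_liminf_lt (by isBoundedDefault)
    (ENNReal.lt_add_right hfin.1.ne hε'.ne')
  have h2 := eventually_lt_of_limsup_lt (ENNReal.lt_add_right hfin.2.ne hε'.ne')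
  refine liminf_le_of_frequently_le' ((h1.and_eventually h2).mono fun r hr ↦ ?_)
  refine (add_le_add hr.1.le hr.2.le).trans_eq ?_
  rw [add_add_add_comm, ENNReal.add_halves]

lemma limsup_add_le_limsup_add_limsup {u w : ℝ → ℝ≥0∞} :
    limsup (fun r ↦ u r + w r) atTop ≤ limsup u atTop + limsup w atTop := by
  refine ENNReal.le_of_forall_pos_le_add fun ε hε hfin ↦ ?_
  rw [ENNReal.add_lt_top] at hfin
  have hε' : (0 : ℝ≥0∞) < ε / 2 := by simpa using hε.ne'
  have h1 := eventually_lt_of_limsup_lt (ENNReal.lt_add_right hfin.1.ne hε'.ne')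
  have h2 := eventually_lt_of_limsup_lt (ENNReal.lt_add_right hfin.2.ne hε'.ne')
  refine limsup_le_of_le (by isBoundedDefault) ?_
  filter_upwards [h1, h2] with r hr1 hr2
  refine (add_le_add hr1.le hr2.le).trans_eq ?_
  rw [add_add_add_comm, ENNReal.add_halves]

lemma limsup_sum_le {ι : Type*} (t : Finset ι) (u : ι → ℝ → ℝ≥0∞) :
    limsup (fun r ↦ ∑ i ∈ t, u i r) atTop ≤ ∑ i ∈ t, limsup (u i) atTop := by
  classical
  induction t using Finset.induction with
  | empty => simp
  | insert i t hi ih =>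
    simp only [Finset.sum_insert hi]
    exact limsup_add_le_limsup_add_limsup.trans (by gcongr)

/-- The growth comparison behind the theorem: an upper bound for the proximity function of a
coefficient gives an inequality between its deficiency and lower growth on one side and the growth
of the other coefficients on the other side. -/
lemma deficiency_mul_liminf_le {ι : Type*} {X Y F : ℂ → ℂ} {t : Finset ι} {Z : ι → ℂ → ℂ}
    {E : ℝ → ℝ} {s e : ℝ} (hse : s < e) (hE : E =O[atTop] fun r ↦ Real.log r ^ s)
    (h : ∀ᶠ r in atTop, proximity X ⊤ r ≤ characteristic Y ⊤ r +
        ((∑ p ∈ t, characteristic (Z p) ⊤ r) + (characteristic F ⊤ r + E r))) :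
    deficiency ⊤ X * liminf (logRatio (characteristic X ⊤) e) atTop ≤
      liminf (logRatio (characteristic Y ⊤) e) atTop +
        (∑ p ∈ t, limsup (logRatio (characteristic (Z p) ⊤) e) atTop +
          limsup (logRatio (characteristic F ⊤) e) atTop) := by
  have h1 : deficiency ⊤ X * liminf (logRatio (characteristic X ⊤) e) atTop ≤
      liminf (logRatio (proximity X ⊤) e) atTop := by
    refine ENNReal.le_liminf_mul.trans (liminf_le_liminf ?_)
    filter_upwards [eventually_one_lt_log] with r hr
    have hp : 0 ≤ proximity X ⊤ r := proximity_nonneg _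
    have hc := characteristic_nonneg (f := X) (a := ⊤) hr.1
    rw [Pi.mul_apply, logRatio, logRatio, ← ENNReal.ofReal_mul (by positivity)]
    refine ENNReal.ofReal_le_ofReal ?_
    rcases hc.eq_or_lt with h0 | h0
    · have := hr.2
      rw [← h0]
      simp only [zero_div, mul_zero]
      positivity
    · rw [div_mul_div_cancel₀ h0.ne']
  have h2 : liminf (logRatio (proximity X ⊤) e) atTop ≤
      liminf (fun r ↦ logRatio (characteristic Y ⊤) e r +
        ((∑ p ∈ t, logRatio (characteristic (Z p) ⊤) e r) +
          (logRatio (characteristic F ⊤) e r + logRatio E e r))) atTop := by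
    refine liminf_le_liminf ?_
    filter_upwards [h, eventually_one_lt_log] with r hr hr1
    have hL : 0 < Real.log r ^ e := by have := hr1.2; positivity
    have h3 : proximity X ⊤ r / Real.log r ^ e ≤ characteristic Y ⊤ r / Real.log r ^ e +
        ((∑ p ∈ t, characteristic (Z p) ⊤ r / Real.log r ^ e) +
          (characteristic F ⊤ r / Real.log r ^ e + E r / Real.log r ^ e)) := by
      rw [← Finset.sum_div, ← add_div, ← add_div, ← add_div]
      gcongr
    simp only [logRatio]
    refine (ENNReal.ofReal_le_ofReal h3).trans ?_
    refine ENNReal.ofReal_add_le.trans (add_le_add le_rfl ?_)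
    refine ENNReal.ofReal_add_le.trans (add_le_add ?_ ENNReal.ofReal_add_le)
    rw [ENNReal.ofReal_sum_of_nonneg]
    intro p _
    exact div_nonneg (characteristic_nonneg hr1.1) hL.le
  refine h1.trans (h2.trans (liminf_add_le_liminf_add_limsup.trans (add_le_add le_rfl ?_)))
  refine limsup_add_le_limsup_add_limsup.trans (add_le_add (limsup_sum_le _ _) ?_)
  refine limsup_add_le_limsup_add_limsup.trans ?_
  rw [(tendsto_logRatio_of_isBigO hse hE).limsup_eq, add_zero]

/-! ### Comparison of the coefficients -/

lemma exists_real_eq_logLowerOrder {g : ℂ → ℂ} (h : 0 < logLowerOrder g)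
    (h' : logLowerOrder g < ⊤) : ∃ μ : ℝ, 0 < μ ∧ logLowerOrder g = μ := by
  lift logLowerOrder g to ℝ using ⟨h'.ne, (EReal.bot_lt_zero.trans h).ne'⟩ with μ
  exact ⟨μ, by exact_mod_cast h, rfl⟩

/-- Under the hypotheses on the coefficients, the coefficient `A l 0` cannot be dominated by the
others up to an error of order `(log r) ^ s` with `s < μ`. -/
lemma not_eventually_proximity_le {n m : ℕ} {A : Fin (n + 1) → Fin (m + 1) → ℂ → ℂ} {F : ℂ → ℂ}
    {a l : Fin (n + 1)} {b : Fin (m + 1)} {μ s : ℝ} (hμ0 : 0 < μ)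
    (hμ : logLowerOrder (A l 0) = μ) (hδ : 0 < deficiency ⊤ (A l 0))
    (hab : logLowerOrder (A a b) ≤ logLowerOrder (A l 0))
    (hS : maxLogOrder A F a l b ≤ logLowerOrder (A l 0))
    (h_ii : logLowerOrder (A l 0) = logLowerOrder (A a b) →
      logLowerType (A a b) < deficiency ⊤ (A l 0) * logLowerType (A l 0))
    (h_iii : logLowerOrder (A l 0) = maxLogOrder A F a l b →
      sumLogType A F a l b < deficiency ⊤ (A l 0) * logLowerType (A l 0))
    (h_iv : logLowerOrder (A l 0) = logLowerOrder (A a b) →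
      logLowerOrder (A a b) = maxLogOrder A F a l b →
      sumLogType A F a l b + logLowerType (A a b) <
          deficiency ⊤ (A l 0) * logLowerType (A l 0))
    (hs : s < μ) {E : ℝ → ℝ} (hE : E =O[atTop] fun r ↦ Real.log r ^ s) :
    ¬ ∀ᶠ r in atTop,
      proximity (A l 0) ⊤ r ≤ characteristic (A a b) ⊤ r +
        ((∑ p ∈ otherIndices a l b, characteristic (A p.1 p.2) ⊤ r) +
          (characteristic F ⊤ r + E r)) := by
  classical
  intro hle
  have hF : logOrder F ≤ maxLogOrder A F a l b := le_max_left _ _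
  have hp {p} (h : p ∈ otherIndices a l b) :
      logOrder (A p.1 p.2) ≤ maxLogOrder A F a l b :=
    (Finset.le_sup (f := fun p : Fin (n + 1) × Fin (m + 1) ↦ logOrder (A p.1 p.2)) h).trans
      (le_max_right _ _)
  have key (e : ℝ) (he : s < e) := deficiency_mul_liminf_le he hE hle
  have hX : liminf (logRatio (characteristic (A l 0) ⊤) μ) atTop = logLowerType (A l 0) :=
    liminf_logRatio_eq_logLowerType hμ
  rw [hμ] at hab hS h_ii h_iii h_iv
  -- If all terms of `S` have smaller order, they do not contribute at the exponent `e`.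
  have hsmall (e : ℝ) (he : maxLogOrder A F a l b < e) :
      ∑ p ∈ otherIndices a l b, limsup (logRatio (characteristic (A p.1 p.2) ⊤) e) atTop +
        limsup (logRatio (characteristic F ⊤) e) atTop = 0 := by
    rw [limsup_logRatio_eq_zero (hF.trans_lt he), add_zero]
    exact Finset.sum_eq_zero fun p h ↦ limsup_logRatio_eq_zero ((hp h).trans_lt he)
  have hsum : ∑ p ∈ otherIndices a l b, limsup (logRatio (characteristic (A p.1 p.2) ⊤) μ) atTop +
        limsup (logRatio (characteristic F ⊤) μ) atTop ≤ sumLogType A F a l b := by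
    rw [sumLogType, Finset.sum_filter]
    refine add_le_add (Finset.sum_le_sum fun p h ↦ ?_) ?_
    · rw [hμ]
      split_ifs with h'
      · exact (limsup_logRatio_eq_logType h').le
      · exact (limsup_logRatio_eq_zero (((hp h).trans hS).lt_of_ne h')).le
    · rcases (hF.trans hS).eq_or_lt with h' | h'
      · exact (limsup_logRatio_eq_logType h').le
      · rw [limsup_logRatio_eq_zero h']; exact zero_le
  rcases hab.eq_or_lt with hab' | hab' <;> rcases hS.eq_or_lt with hS' | hS'
  · have h1 := h_iv hab'.symm (hab'.trans hS'.symm)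
    have h2 := key μ hs
    rw [hX, liminf_logRatio_eq_logLowerType hab'] at h2
    exact absurd (h1.trans_le h2) (by rw [add_comm]; exact not_lt.2 (by gcongr))
  · have h1 := h_ii hab'.symm
    have h2 := key μ hs
    rw [hX, liminf_logRatio_eq_logLowerType hab', hsmall μ hS', add_zero] at h2
    exact absurd (h1.trans_le h2) (lt_irrefl _)
  · have h1 := h_iii hS'.symm
    have h2 := key μ hs
    rw [hX, liminf_logRatio_eq_zero hab', zero_add] at h2
    exact absurd (h1.trans_le h2) (not_lt.2 hsum)
  · -- No competing term has order `μ`: compare at an exponent slightly smaller than `μ`.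
    have h0 : max (max (logLowerOrder (A a b)) (maxLogOrder A F a l b)) ((max s 0 : ℝ) : EReal)
        < (μ : EReal) :=
      max_lt (max_lt hab' hS') (EReal.coe_lt_coe_iff.2 (max_lt hs hμ0))
    obtain ⟨e, he1, he2⟩ := EReal.lt_iff_exists_real_btwn.1 h0
    rw [max_lt_iff, max_lt_iff] at he1
    have he3 : max s 0 < e := EReal.coe_lt_coe_iff.1 he1.2
    have h2 := key e ((le_max_left _ _).trans_lt he3)
    rw [liminf_logRatio_eq_zero he1.1.1, hsmall e he1.1.2, add_zero] at h2
    have h3 := one_le_liminf_logRatio (g := A l 0) ((le_max_right s 0).trans he3.le)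
      (by rw [hμ]; exact he2)
    have h4 := le_mul_of_one_le_right (zero_le (a := deficiency ⊤ (A l 0))) h3
    exact absurd (h4.trans h2) (not_le.2 hδ)

end LogGrowth

open LogGrowth in
theorem theorem1p2 {n m : ℕ} (c : Fin (n + 1) → ℂ) (hc : Function.Injective c)
    (A : Fin (n + 1) → Fin (m + 1) → ℂ → ℂ) (F : ℂ → ℂ)
    (hA : ∀ i j, Meromorphic (A i j)) (hF : Meromorphic F)
    (a l : Fin (n + 1)) (b : Fin (m + 1)) (hab : (a, b) ≠ (l, 0))
    (hμ : 0 < logLowerOrder (A l 0)) (hδ : 0 < deficiency ⊤ (A l 0))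
    (h_i : max (logLowerOrder (A a b)) (maxLogOrder A F a l b) ≤ logLowerOrder (A l 0) ∧
      logLowerOrder (A l 0) < ⊤)
    (h_ii : logLowerOrder (A l 0) = logLowerOrder (A a b) →
      logLowerType (A a b) < deficiency ⊤ (A l 0) * logLowerType (A l 0))
    (h_iii : logLowerOrder (A l 0) = maxLogOrder A F a l b →
      sumLogType A F a l b < deficiency ⊤ (A l 0) * logLowerType (A l 0) ∧
        deficiency ⊤ (A l 0) * logLowerType (A l 0) < ⊤)
    (h_iv : logLowerOrder (A l 0) = logLowerOrder (A a b) →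
      logLowerOrder (A a b) = maxLogOrder A F a l b →
      sumLogType A F a l b + logLowerType (A a b) <
          deficiency ⊤ (A l 0) * logLowerType (A l 0) ∧
        deficiency ⊤ (A l 0) * logLowerType (A l 0) < ⊤) :
    (¬ F =ᶠ[codiscrete ℂ] 0 →
      ∀ f : ℂ → ℂ, IsMeromorphicSolution c A F f → logLowerOrder (A l 0) ≤ logOrder f) ∧
    (F =ᶠ[codiscrete ℂ] 0 →
      ∀ f : ℂ → ℂ, IsMeromorphicSolution c A 0 f → ¬ f =ᶠ[codiscrete ℂ] 0 →
        logLowerOrder (A l 0) + 1 ≤ logOrder f) := by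
  obtain ⟨μ, hμ0, hμe⟩ := exists_real_eq_logLowerOrder hμ h_i.2
  have hcontra (s : ℝ) (hs : s < μ) (E : ℝ → ℝ)
      (hE : E =O[atTop] fun r ↦ Real.log r ^ s) :=
    not_eventually_proximity_le hμ0 hμe hδ ((le_max_left _ _).trans h_i.1)
      ((le_max_right _ _).trans h_i.1) h_ii (fun h ↦ (h_iii h).1) (fun h h' ↦ (h_iv h h').1) hs hE
  constructor
  · intro hF0 f hf
    by_contra! hlt
    rw [hμe] at hlt
    obtain ⟨q, hq, hqμ⟩ := EReal.lt_iff_exists_real_btwn.1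
      (max_lt hlt (EReal.coe_lt_coe_iff.2 hμ0))
    rw [max_lt_iff] at hq
    have hq0 : 0 < q := EReal.coe_lt_coe_iff.1 hq.2
    have hf0 : ¬ f =ᶠ[codiscrete ℂ] 0 := by
      intro h
      apply hF0
      have h1 : ∀ᶠ z in codiscrete ℂ, ∀ i : Fin (n + 1), ∀ j : Fin (m + 1),
          iteratedDeriv (j : ℕ) f (z + c i) = 0 := by
        rw [eventually_all]; intro i
        rw [eventually_all]; intro j
        filter_upwards [eventuallyEq_comp_add (eventuallyEq_iteratedDeriv h j) (c i)] with z hz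
        rw [hz, iteratedDeriv_const_zero]
      filter_upwards [hf.2, h1] with z hz hz1
      rw [← hz]
      simp [hz1]
    have hT := isBigO_characteristic_of_logOrder_lt hq.1
    have hT' := isBigO_characteristic_of_logOrder_lt (g := f) (e := q + 1)
      (hq.1.trans (EReal.coe_lt_coe_iff.2 (by linarith)))
    obtain ⟨E, hE, hle⟩ := proximity_coefficient_le hA hF hab hf hf0 hq0.le hT' (Or.inr hT)
    exact hcontra q (EReal.coe_lt_coe_iff.1 hqμ) E hE hle
  · intro hF0 f hf hf0
    by_contra! hlt
    rw [hμe] at hlt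
    have h1 : logOrder f < ((μ + 1 : ℝ) : EReal) := by simpa using hlt
    obtain ⟨q, hq, hqμ⟩ := EReal.lt_iff_exists_real_btwn.1
      (max_lt h1 (EReal.coe_lt_coe_iff.2 (show (1 : ℝ) < μ + 1 by linarith)))
    rw [max_lt_iff] at hq
    have hq1 : 1 < q := EReal.coe_lt_coe_iff.1 hq.2
    have hq2 : q < μ + 1 := EReal.coe_lt_coe_iff.1 hqμ
    have hT := isBigO_characteristic_of_logOrder_lt hq.1
    have hf' : IsMeromorphicSolution c A F f := ⟨hf.1, hf.2.trans hF0.symm⟩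
    obtain ⟨E, hE, hle⟩ := proximity_coefficient_le hA hF hab hf' hf0 (s := q - 1) (by linarith)
      (by simpa using hT) (Or.inl hF0)
    exact hcontra (q - 1) (by linarith) E hE hle
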